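/- Let $q\ge 2$ be an integer and let $\mathcal X$ be a homogeneous tree of degree $q+1$ (a connected graph without cycles in which every vertex has $q+1$ neighbours), with graph distance $d$ and a fixed vertex $o$; write $|x|=d(o,x)$. Let $\Omega$ be the set of infinite geodesic rays $\omega=(\omega_0,\omega_1,\dots)$ with $\omega_0=o$. For $x\in\mathcal X$ and $\omega\in\Omega$ let $c(x,\omega)$ be the last vertex on the geodesic path from $o$ to $x$ that lies on $\omega$, let $E(x)=\{\omega\in\Omega:|c(x,\omega)|\ge|x|\}$, and let $\nu$ be the probability measure on the $\sigma$-algebra generated by the sets $E(x)$ with $\nu(E(o))=1$ and $\nu(E(x))=\frac1{(q+1)q^{|x|-1}}$ for $x\ne o$. For $z\in\mathbb C$ and $F\in L^1(\Omega,\nu)$ put $$\mathcal P_zF(x)=\int_\Omega p(x,\omega)^{1/2+iz}F(\omega)\,d\nu(\omega),\qquad p(x,\omega)=q^{2|c(x,\omega)|-|x|},\qquad x\in\mathcal X.$$ For $u:\mathcal X\to\mathbb C$ let $\mathcal Lu(x)=u(x)-\frac1{q+1}\sum_{y:d(x,y)=1}u(y)$. Let $$\gamma(z)=1-\frac{q^{1/2+iz}+q^{1/2-iz}}{q+1},\qquad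 \mathbf c(z)=\frac{q^{1/2}}{q+1}\,\frac{q^{1/2+iz}-q^{-1/2-iz}}{q^{iz}-q^{-iz}},\qquad \tau=\frac{2\pi}{\log q}.$$ Let $K$ be the compact group of isometries of $\mathcal X$ fixing $o$, $dk$ its normalised Haar measure, and fix a ray $(\omega_0,\omega_1,\dots)\in\Omega$. For $1<r<\infty$ let $\mathcal H^r_*(\mathcal X)$ be the space of all $u:\mathcal X\to\mathbb C$ with $$\|u\|_{\mathcal H^r_*(\mathcal X)}=\sup_{n\ge0}\,q^{n/2}\Big(\int_K|u(k\cdot\omega_n)|^r\,dk\Big)^{1/r}<\infty .$$ **Theorem.** Let $1<r<\infty$. (a) For every $z\in\mathbb R\setminus(\tau/2)\mathbb Z$ and every $u:\mathcal X\to\mathbb C$: $u=\mathcal P_zF$ for some $F\in L^r(\Omega)$ if and only if $u\in\mathcal H^r_*(\mathcal X)$ and $\mathcal Lu=\gamma(z)u$. (b) There exist positive constants $C_{1,r}$ and $C_{2,r}$, independent of $z$ and $F$ (the tree being fixed), such that for all $z\in\mathbb R\setminus(\tau/2)\mathbb Z$ and all $F\in L^r(\Omega)$, $$C_{1,r}\,|\mathbf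 c(z)|\,\|F\|_{L^r(\Omega)}\le\|\mathcal P_zF\|_{\mathcal H^r_*(\mathcal X)}\le C_{2,r}\,|\mathbf c(z)|\,\|F\|_{L^r(\Omega)} .$$ -/

import Mathlib

open MeasureTheory Topology
open scoped ENNReal

namespace HomTree

variable {V : Type*}

/-! ### Homogeneous trees and the isotropy group of the root -/

/-- `G` is a homogeneous tree of degree `q + 1`, where `q ≥ 2`. -/
structure IsHomogeneousTree (G : SimpleGraph V) [G.LocallyFinite] (q : ℕ) : Prop where
  two_le : 2 ≤ q
  isTree : G.IsTree
  regular : G.IsRegularOfDegree (q + 1)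

/-- The group `K` of all isometries of `(V, d)` that fix `o`. -/
def rootStabilizer (G : SimpleGraph V) (o : V) : Subgroup (Equiv.Perm V) where
  carrier := {g | (∀ x y, G.dist (g x) (g y) = G.dist x y) ∧ g o = o}
  mul_mem' := by
    rintro a b ⟨ha, ha'⟩ ⟨hb, hb'⟩
    exact ⟨fun x y => by simp [ha, hb], by simp [ha', hb']⟩
  one_mem' := ⟨fun _ _ => rfl, rfl⟩
  inv_mem' := by
    rintro a ⟨ha, ha'⟩
    refine ⟨fun x y => ?_, ?_⟩
    · rw [← ha]; simp
    · rw [Equiv.Perm.inv_eq_iff_eq, ha']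

/-- `K` carries the topology of pointwise convergence on the discrete set of vertices. -/
instance rootStabilizerTopology (G : SimpleGraph V) (o : V) :
    TopologicalSpace (rootStabilizer G o) :=
  TopologicalSpace.induced (fun g v => (g : Equiv.Perm V) v)
    (@Pi.topologicalSpace V (fun _ => V) (fun _ => ⊥))

instance rootStabilizerMeasurableSpace (G : SimpleGraph V) (o : V) :
    MeasurableSpace (rootStabilizer G o) := borel _

instance rootStabilizerBorelSpace (G : SimpleGraph V) (o : V) :
    BorelSpace (rootStabilizer G o) := ⟨rfl⟩

section Group

variable {G : SimpleGraph V} {o : V}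

theorem isOpen_setOf_apply_eq (x y : V) :
    IsOpen {k : rootStabilizer G o | (k : Equiv.Perm V) x = y} := by
  let _ : TopologicalSpace V := ⊥
  have _ : DiscreteTopology V := ⟨rfl⟩
  have h : Continuous (fun (k : rootStabilizer G o) (v : V) => (k : Equiv.Perm V) v) :=
    continuous_induced_dom
  exact (isOpen_discrete {y}).preimage ((continuous_apply x).comp h)

instance rootStabilizerIsTopologicalGroup : IsTopologicalGroup (rootStabilizer G o) where
  continuous_mul := by
    let _ : TopologicalSpace V := ⊥
    have _ : DiscreteTopology V := ⟨rfl⟩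
    refine continuous_induced_rng.2 (continuous_pi fun v => ?_)
    refine continuous_discrete_rng.2 fun w => ?_
    rw [isOpen_iff_mem_nhds]
    rintro ⟨a, b⟩ hab
    have h := ((isOpen_setOf_apply_eq (G := G) (o := o) ((b : Equiv.Perm V) v) w).prod
      (isOpen_setOf_apply_eq (G := G) (o := o) v ((b : Equiv.Perm V) v)))
    refine Filter.mem_of_superset (h.mem_nhds ⟨?_, rfl⟩) ?_
    · simpa using hab
    · rintro ⟨c, d⟩ ⟨hc, hd⟩
      change (c : Equiv.Perm V) _ = w at hc
      change (d : Equiv.Perm V) v = _ at hd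
      simp [hc, hd]
  continuous_inv := by
    let _ : TopologicalSpace V := ⊥
    have _ : DiscreteTopology V := ⟨rfl⟩
    refine continuous_induced_rng.2 (continuous_pi fun v => ?_)
    refine continuous_discrete_rng.2 fun w => ?_
    convert isOpen_setOf_apply_eq (G := G) (o := o) w v using 1
    ext k
    change (k : Equiv.Perm V)⁻¹ v = w ↔ (k : Equiv.Perm V) w = v
    rw [Equiv.Perm.inv_eq_iff_eq, eq_comm]

theorem exists_parent (hG : G.Connected) (o : V) {x : V} (hx : x ≠ o) :
    ∃ w, G.Adj w x ∧ G.dist o w + 1 = G.dist o x := by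
  obtain ⟨p, hp⟩ := hG.exists_walk_length_eq_dist o x
  have hpos : 0 < G.dist o x := hG.pos_dist_of_ne hx.symm
  have hn : ¬ p.Nil := by
    intro h
    have := SimpleGraph.Walk.length_eq_zero_iff.2 h
    omega
  have hadj := p.adj_penultimate hn
  have h1 := G.dist_le p.dropLast
  have h3 : p.dropLast.length + 1 = p.length := by
    have := congrArg SimpleGraph.Walk.length (p.concat_dropLast hadj)
    rwa [SimpleGraph.Walk.length_concat] at this
  have h2 := hG.dist_triangle (u := o) (v := p.penultimate) (w := x)
  rw [SimpleGraph.dist_eq_one_iff_adj.2 hadj] at h2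
  exact ⟨p.penultimate, hadj, by omega⟩

theorem parent_unique (hG : G.IsTree) (o : V) {x a b : V} (ha : G.Adj a x)
    (ha' : G.dist o a + 1 = G.dist o x) (hb : G.Adj b x) (hb' : G.dist o b + 1 = G.dist o x) :
    a = b := by
  obtain ⟨p, hp⟩ := hG.connected.exists_walk_length_eq_dist o a
  obtain ⟨r, hr⟩ := hG.connected.exists_walk_length_eq_dist o b
  have h1 : (p.concat ha).IsPath := SimpleGraph.Walk.isPath_of_length_eq_dist _ (by
    rw [SimpleGraph.Walk.length_concat]; omega)
  have h2 : (r.concat hb).IsPath := SimpleGraph.Walk.isPath_of_length_eq_dist _ (by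
    rw [SimpleGraph.Walk.length_concat]; omega)
  have h0 := hG.isAcyclic.subsingleton_path o x
  have h3 := congrArg Subtype.val
    (Subsingleton.elim (⟨_, h1⟩ : G.Path o x) (⟨_, h2⟩ : G.Path o x))
  have h4 := congrArg SimpleGraph.Walk.penultimate h3
  simpa using h4

theorem finite_sphere [G.LocallyFinite] (hG : G.Connected) (o : V) (n : ℕ) :
    {x | G.dist o x = n}.Finite := by
  induction n with
  | zero =>
    refine (Set.finite_singleton o).subset fun x hx => ?_
    exact ((hG.dist_eq_zero_iff).1 hx).symm
  | succ n ih =>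
    refine (ih.biUnion fun x _ => (G.neighborFinset x).finite_toSet).subset fun x hx => ?_
    have hx' : G.dist o x = n + 1 := hx
    obtain ⟨w, hw, hw'⟩ := exists_parent hG o (x := x) (by rintro rfl; simp at hx')
    simp only [Set.mem_iUnion, Finset.mem_coe, SimpleGraph.mem_neighborFinset]
    exact ⟨w, show G.dist o w = n by omega, hw⟩

theorem dist_root_apply (k : rootStabilizer G o) (v : V) :
    G.dist o ((k : Equiv.Perm V) v) = G.dist o v := by
  have h := k.2.1 o v
  rwa [k.2.2] at h

theorem rootStabilizer_compactSpace [G.LocallyFinite] (hG : G.Connected) :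
    CompactSpace (rootStabilizer G o) := by
  let _ : TopologicalSpace V := ⊥
  have _ : DiscreteTopology V := ⟨rfl⟩
  let f : rootStabilizer G o → V → V := fun g v => (g : Equiv.Perm V) v
  have hf : IsInducing f := ⟨rfl⟩
  refine ⟨hf.isCompact_iff.2 ?_⟩
  have hP : IsCompact (Set.univ.pi fun v => {w | G.dist o w = G.dist o v}) :=
    isCompact_univ_pi fun v => (finite_sphere hG o _).isCompact
  refine hP.of_isClosed_subset (?_ : IsClosed (f '' Set.univ)) ?_
  · have himg : f '' Set.univ = {φ : V → V | φ o = o} ∩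
        ⋂ x, ⋂ y, {φ : V → V | G.dist (φ x) (φ y) = G.dist x y} := by
      ext φ
      simp only [Set.image_univ, Set.mem_range, Set.mem_inter_iff, Set.mem_iInter]
      constructor
      · rintro ⟨k, rfl⟩
        exact ⟨k.2.2, k.2.1⟩
      · rintro ⟨h0, h1⟩
        change φ o = o at h0
        change ∀ x y, G.dist (φ x) (φ y) = G.dist x y at h1
        have hinj : Function.Injective φ := fun x y hxy => by
          have := h1 x y
          rw [hxy, SimpleGraph.dist_self] at this
          exact hG.dist_eq_zero_iff.1 this.symm
        have hsurj : Function.Surjective φ := fun y => by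
          have hmaps : Set.MapsTo φ {x | G.dist o x = G.dist o y} {x | G.dist o x = G.dist o y} :=
            fun x hx => by
              change G.dist o (φ x) = _
              rw [← (hx : G.dist o x = G.dist o y), ← h1 o x, h0]
          have := ((Set.Finite.injOn_iff_bijOn_of_mapsTo
            (finite_sphere hG o (G.dist o y)) hmaps).1 hinj.injOn).surjOn
          obtain ⟨x, -, hx⟩ := this (show G.dist o y = G.dist o y from rfl)
          exact ⟨x, hx⟩
        exact ⟨⟨Equiv.ofBijective φ ⟨hinj, hsurj⟩, h1, h0⟩, rfl⟩
    rw [himg]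
    refine IsClosed.inter ((isClosed_discrete {o}).preimage
      (continuous_apply (A := fun _ : V => V) o)) ?_
    refine isClosed_iInter fun x => isClosed_iInter fun y => ?_
    exact (isClosed_discrete {p : V × V | G.dist p.1 p.2 = G.dist x y}).preimage
      ((continuous_apply (A := fun _ : V => V) x).prodMk (continuous_apply (A := fun _ : V => V) y))
  · rintro _ ⟨k, -, rfl⟩ v -
    exact dist_root_apply k v

open Classical in
/-- The neighbours of `v` that are farther from `o` than `v` is. -/
noncomputable def children (G : SimpleGraph V) [G.LocallyFinite] (o v : V) : Finset V :=
  {w ∈ G.neighborFinset v | G.dist o w = G.dist o v + 1}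

theorem mem_children [G.LocallyFinite] {v w : V} :
    w ∈ children G o v ↔ G.Adj v w ∧ G.dist o w = G.dist o v + 1 := by
  simp [children]

theorem card_children_root [G.LocallyFinite] {q : ℕ} (hG : IsHomogeneousTree G q) :
    (children G o o).card = q + 1 := by
  rw [← hG.regular o, ← SimpleGraph.card_neighborFinset_eq_degree]
  congr 1
  ext w
  simp only [mem_children, SimpleGraph.mem_neighborFinset, SimpleGraph.dist_self, zero_add,
    SimpleGraph.dist_eq_one_iff_adj, and_self]

theorem card_children_of_ne [G.LocallyFinite] {q : ℕ} (hG : IsHomogeneousTree G q) {v : V}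
    (hv : v ≠ o) : (children G o v).card = q := by
  classical
  obtain ⟨w, hw, hw'⟩ := exists_parent hG.isTree.connected o hv
  have h : children G o v = (G.neighborFinset v).erase w := by
    ext x
    rw [mem_children, Finset.mem_erase, SimpleGraph.mem_neighborFinset]
    constructor
    · rintro ⟨h1, h2⟩
      exact ⟨by rintro rfl; omega, h1⟩
    · rintro ⟨h1, h2⟩
      refine ⟨h2, ?_⟩
      rcases hG.isTree.dist_eq_dist_add_one_of_adj o h2 with h3 | h3
      · exact absurd (parent_unique hG.isTree o h2.symm h3.symm hw hw') h1
      · exact h3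
  rw [h, Finset.card_erase_of_mem (by simpa using hw.symm),
    SimpleGraph.card_neighborFinset_eq_degree, hG.regular v]
  simp

/-- The isometries fixing `o` act transitively on the spheres centred at `o`. -/
theorem exists_apply_eq [G.LocallyFinite] {q : ℕ} (hG : IsHomogeneousTree G q) {x y : V}
    (hxy : G.dist o x = G.dist o y) : ∃ k : rootStabilizer G o, (k : Equiv.Perm V) x = y := by
  classical
  have hpar : ∀ v, ∃ w, G.dist o w = G.dist o v - 1 ∧ (v ≠ o → v ∈ children G o w) := by
    intro v
    by_cases hv : v = o
    · exact ⟨o, by simp [hv], fun h => absurd hv h⟩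
    · obtain ⟨w, hw, hw'⟩ := exists_parent hG.isTree.connected o hv
      exact ⟨w, by omega, fun _ => mem_children.2 ⟨hw, hw'.symm⟩⟩
  choose par hpard hparc using hpar
  have hpar_eq : ∀ {v w}, w ∈ children G o v → par w = v := by
    intro v w hw
    have hw' := mem_children.1 hw
    have hwo : w ≠ o := by
      rintro rfl
      simp at hw'
    have h1 := mem_children.1 (hparc w hwo)
    exact parent_unique hG.isTree o h1.1 h1.2.symm hw'.1 hw'.2.symm
  have hiter : ∀ i v, G.dist o (par^[i] v) = G.dist o v - i := by
    intro i v
    induction i with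
    | zero => simp
    | succ i ih => rw [Function.iterate_succ_apply', hpard, ih]; omega
  have hcard : ∀ {a b}, G.dist o a = G.dist o b →
      (children G o a).card = (children G o b).card := by
    intro a b hab
    by_cases ha : a = o
    · have hb : b = o := by
        rw [ha, SimpleGraph.dist_self] at hab
        exact (hG.isTree.connected.dist_eq_zero_iff.1 hab.symm).symm
      rw [ha, hb]
    · have hb : b ≠ o := by
        rintro rfl
        rw [SimpleGraph.dist_self] at hab
        exact ha (hG.isTree.connected.dist_eq_zero_iff.1 hab).symm
      rw [card_children_of_ne hG ha, card_children_of_ne hG hb]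
  have hσ : ∀ a b, ∃ σ : V → V, G.dist o a = G.dist o b →
      Set.BijOn σ (children G o a) (children G o b) ∧
      ∀ s ∈ children G o a, ∀ t ∈ children G o b,
        s = par^[G.dist o x - G.dist o s] x → t = par^[G.dist o y - G.dist o t] y → σ s = t := by
    intro a b
    by_cases hab : G.dist o a = G.dist o b
    swap
    · exact ⟨id, fun h => absurd h hab⟩
    let e := Finset.equivOfCardEq (hcard hab)
    let f : V → V := fun v => if h : v ∈ children G o a then e ⟨v, h⟩ else v
    have hfv : ∀ v (h : v ∈ children G o a), f v = e ⟨v, h⟩ := fun v h => dif_pos h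
    have hf : Set.BijOn f (children G o a) (children G o b) := by
      refine ⟨fun v hv => ?_, fun v hv w hw hvw => ?_, fun w hw => ?_⟩
      · rw [hfv v hv]; exact (e ⟨v, hv⟩).2
      · rw [hfv v hv, hfv w hw] at hvw
        simpa using e.injective (Subtype.ext hvw)
      · refine ⟨e.symm ⟨w, hw⟩, (e.symm ⟨w, hw⟩).2, ?_⟩
        rw [hfv _ (e.symm ⟨w, hw⟩).2]
        simp
    by_cases hst : ∃ s ∈ children G o a, ∃ t ∈ children G o b,
        s = par^[G.dist o x - G.dist o s] x ∧ t = par^[G.dist o y - G.dist o t] y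
    · obtain ⟨s, hs, t, ht, hs', ht'⟩ := hst
      have hsw : Set.BijOn (Equiv.swap (f s) t) (children G o b) (children G o b) := by
        have hm : Set.MapsTo (Equiv.swap (f s) t) (children G o b) (children G o b) := by
          intro w hw
          by_cases h1 : w = f s
          · rw [h1, Equiv.swap_apply_left]; exact ht
          · by_cases h2 : w = t
            · rw [h2, Equiv.swap_apply_right]; exact hf.1 hs
            · rwa [Equiv.swap_apply_of_ne_of_ne h1 h2]
        refine ⟨hm, (Equiv.injective _).injOn, fun w hw => ⟨_, hm hw, ?_⟩⟩
        exact Equiv.swap_apply_self (f s) t w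
      refine ⟨_, fun _ => ⟨hsw.comp hf, fun s₁ hs₁ t₁ ht₁ hs₁' ht₁' => ?_⟩⟩
      have e1 : s₁ = s := by
        rw [hs₁', hs', (mem_children.1 hs).2, (mem_children.1 hs₁).2]
      have e2 : t₁ = t := by
        rw [ht₁', ht', (mem_children.1 ht).2, (mem_children.1 ht₁).2]
      rw [e1, e2, Function.comp_apply, Equiv.swap_apply_left]
    · exact ⟨f, fun _ => ⟨hf, fun s hs t ht hs' ht' =>
        absurd ⟨s, hs, t, ht, hs', ht'⟩ hst⟩⟩
  choose σ hσ using hσ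
  let gn : ℕ → V → V := fun n => Nat.rec id (fun _ ih v => σ (par v) (ih (par v)) v) n
  let g : V → V := fun v => gn (G.dist o v) v
  have hg : ∀ v, v ≠ o → g v = σ (par v) (g (par v)) v := by
    intro v hv
    have h1 : G.dist o v = G.dist o (par v) + 1 := (mem_children.1 (hparc v hv)).2
    change gn (G.dist o v) v = _
    rw [h1]
  have hgo : g o = o := by
    change gn (G.dist o o) o = o
    rw [SimpleGraph.dist_self]
    rfl
  have hgd : ∀ n v, G.dist o v = n → G.dist o (g v) = n := by
    intro n
    induction n with
    | zero =>
      intro v hv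
      rw [← hG.isTree.connected.dist_eq_zero_iff.1 hv, hgo, SimpleGraph.dist_self]
    | succ n ih =>
      intro v hv
      have hvo : v ≠ o := by
        rintro rfl
        simp at hv
      have h1 := hparc v hvo
      have h2 : G.dist o (par v) = n := by
        have := (mem_children.1 h1).2
        omega
      have h3 := ih _ h2
      have h4 := (hσ (par v) (g (par v)) (h2.trans h3.symm)).1.1 h1
      rw [hg v hvo, (mem_children.1 h4).2, h3]
  have hgd' : ∀ v, G.dist o (g v) = G.dist o v := fun v => hgd _ v rfl
  have hgc : ∀ v w, w ∈ children G o v → g w ∈ children G o (g v) := by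
    intro v w hw
    have hwo : w ≠ o := by
      rintro rfl
      have := (mem_children.1 hw).2
      simp at this
    rw [hg w hwo, hpar_eq hw]
    exact (hσ v (g v) (hgd' v).symm).1.1 hw
  have hne : ∀ v, v ≠ o → g v ≠ o := by
    intro v hv h
    have := hgd' v
    rw [h, SimpleGraph.dist_self] at this
    exact hv (hG.isTree.connected.dist_eq_zero_iff.1 this.symm).symm
  have hpg : ∀ v, v ≠ o → par (g v) = g (par v) := fun v hv => hpar_eq (hgc _ _ (hparc v hv))
  have hinj : ∀ n v w, G.dist o v = n → g v = g w → v = w := by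
    intro n
    induction n with
    | zero =>
      intro v w hv hvw
      have h1 := hgd' w
      rw [← hvw, hgd' v, hv] at h1
      rw [← hG.isTree.connected.dist_eq_zero_iff.1 hv,
        ← hG.isTree.connected.dist_eq_zero_iff.1 h1.symm]
    | succ n ih =>
      intro v w hv hvw
      have h1 := hgd' w
      rw [← hvw, hgd' v, hv] at h1
      have hvo : v ≠ o := by
        rintro rfl
        simp at hv
      have hwo : w ≠ o := by
        rintro rfl
        simp at h1
      have h2 : par v = par w := by
        refine ih _ _ ?_ ?_
        · rw [hpard, hv]; rfl
        · rw [← hpg v hvo, ← hpg w hwo, hvw]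
      rw [hg v hvo, hg w hwo, h2] at hvw
      have h3 := hparc v hvo
      rw [h2] at h3
      exact (hσ _ _ (hgd' (par w)).symm).1.2.1 h3 (hparc w hwo) hvw
  have hsurj : ∀ n w, G.dist o w = n → ∃ v, g v = w := by
    intro n
    induction n with
    | zero =>
      intro w hw
      exact ⟨o, by rw [hgo, hG.isTree.connected.dist_eq_zero_iff.1 hw]⟩
    | succ n ih =>
      intro w hw
      have hwo : w ≠ o := by
        rintro rfl
        simp at hw
      obtain ⟨a, ha⟩ := ih (par w) (by rw [hpard, hw]; rfl)
      have h1 := hparc w hwo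
      rw [← ha] at h1
      obtain ⟨v, hv, hv'⟩ := (hσ a (g a) (hgd' a).symm).1.2.2 h1
      have hvo : v ≠ o := by
        rintro rfl
        have := (mem_children.1 hv).2
        simp at this
      exact ⟨v, by rw [hg v hvo, hpar_eq hv, hv']⟩
  have hgx : ∀ j, j ≤ G.dist o x → g (par^[G.dist o x - j] x) = par^[G.dist o x - j] y := by
    intro j
    induction j with
    | zero =>
      intro _
      have h1 := hiter (G.dist o x) x
      have h2 := hiter (G.dist o x) y
      rw [Nat.sub_self] at h1
      rw [hxy, Nat.sub_self, ← hxy] at h2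
      rw [Nat.sub_zero, ← hG.isTree.connected.dist_eq_zero_iff.1 h1,
        ← hG.isTree.connected.dist_eq_zero_iff.1 h2, hgo]
    | succ j ih =>
      intro hj
      have ih := ih (by omega)
      have e : G.dist o x - j = (G.dist o x - (j + 1)) + 1 := by omega
      rw [e, Function.iterate_succ_apply', Function.iterate_succ_apply'] at ih
      have hs := hiter (G.dist o x - (j + 1)) x
      have ht := hiter (G.dist o x - (j + 1)) y
      rw [← hxy] at ht
      have hd : G.dist o x - (G.dist o x - (j + 1)) = j + 1 := by omega
      rw [hd] at hs ht
      have hso : par^[G.dist o x - (j + 1)] x ≠ o := by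
        intro h
        rw [h] at hs
        simp at hs
      have hto : par^[G.dist o x - (j + 1)] y ≠ o := by
        intro h
        rw [h] at ht
        simp at ht
      rw [hg _ hso, ih]
      refine (hσ _ _ ?_).2 _ (hparc _ hso) _ (hparc _ hto) ?_ ?_
      · rw [hpard, hpard, hs, ht]
      · rw [hs]
      · rw [ht, ← hxy]
  have hgxy : g x = y := by simpa using hgx _ le_rfl
  have hadj : ∀ v w, G.Adj (g v) (g w) ↔ G.Adj v w := by
    have h1 : ∀ v w, G.Adj v w → G.Adj (g v) (g w) := by
      intro v w h
      rcases hG.isTree.dist_eq_dist_add_one_of_adj o h with h2 | h2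
      · exact (mem_children.1 (hgc w v (mem_children.2 ⟨h.symm, h2⟩))).1.symm
      · exact (mem_children.1 (hgc v w (mem_children.2 ⟨h, h2⟩))).1
    have h3 : ∀ v w, g w ∈ children G o (g v) → G.Adj v w := by
      intro v w h
      have hwo : w ≠ o := by
        rintro rfl
        have := (mem_children.1 h).2
        rw [hgo] at this
        simp at this
      have h4 := hpar_eq h
      rw [hpg w hwo] at h4
      have h5 := hinj _ _ _ rfl h4
      have h6 := hparc w hwo
      rw [h5] at h6
      exact (mem_children.1 h6).1
    refine fun v w => ⟨fun h => ?_, h1 v w⟩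
    rcases hG.isTree.dist_eq_dist_add_one_of_adj o h with h2 | h2
    · exact (h3 w v (mem_children.2 ⟨h.symm, h2⟩)).symm
    · exact h3 v w (mem_children.2 ⟨h, h2⟩)
  let ge : V ≃ V := Equiv.ofBijective g ⟨fun v w h => hinj _ v w rfl h, fun w => hsurj _ w rfl⟩
  let gi : G ≃g G := ⟨ge, fun {a b} => hadj a b⟩
  have hle : ∀ (φ : G →g G) (a b : V), G.dist (φ a) (φ b) ≤ G.dist a b := by
    intro φ a b
    obtain ⟨p, hp⟩ := hG.isTree.connected.exists_walk_length_eq_dist a b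
    rw [← hp, ← SimpleGraph.Walk.length_map φ p]
    exact G.dist_le _
  refine ⟨⟨ge, fun a b => le_antisymm (hle gi.toHom a b) ?_, hgo⟩, hgxy⟩
  have := hle gi.symm.toHom (ge a) (ge b)
  have e1 : ∀ c, gi.symm.toHom (ge c) = c := fun c => ge.symm_apply_apply c
  rwa [e1, e1] at this

theorem card_sphere [G.LocallyFinite] {q : ℕ} (hG : IsHomogeneousTree G q) (o : V) (n : ℕ) :
    (finite_sphere hG.isTree.connected o n).toFinset.card =
      if n = 0 then 1 else (q + 1) * q ^ (n - 1) := by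
  classical
  have hc := hG.isTree.connected
  have h0 : (finite_sphere hc o 0).toFinset = {o} := by
    ext x
    rw [Set.Finite.mem_toFinset, Finset.mem_singleton]
    exact hc.dist_eq_zero_iff.trans eq_comm
  have hstep : ∀ n, (finite_sphere hc o (n + 1)).toFinset =
      (finite_sphere hc o n).toFinset.biUnion (children G o) := by
    intro n
    ext x
    rw [Set.Finite.mem_toFinset, Finset.mem_biUnion]
    constructor
    · intro hx
      have hx' : G.dist o x = n + 1 := hx
      obtain ⟨w, hw, hw'⟩ := exists_parent hc o (x := x) (by rintro rfl; simp at hx')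
      exact ⟨w, (Set.Finite.mem_toFinset _).2 (show G.dist o w = n by omega),
        mem_children.2 ⟨hw, hw'.symm⟩⟩
    · rintro ⟨w, hw, hwx⟩
      have hw' : w ∈ {x | G.dist o x = n} := (Set.Finite.mem_toFinset _).1 hw
      change G.dist o w = n at hw'
      change G.dist o x = n + 1
      rw [(mem_children.1 hwx).2, hw']
  have hdisj : ∀ n, (((finite_sphere hc o n).toFinset : Finset V) : Set V).PairwiseDisjoint
      (children G o) := by
    intro n a _ b _ hab
    refine Finset.disjoint_left.2 fun x ha hb => hab ?_
    have ha' := mem_children.1 ha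
    have hb' := mem_children.1 hb
    exact parent_unique hG.isTree o ha'.1 ha'.2.symm hb'.1 hb'.2.symm
  have hmain : ∀ n, (finite_sphere hc o (n + 1)).toFinset.card = (q + 1) * q ^ n := by
    intro n
    induction n with
    | zero => rw [hstep, h0, Finset.singleton_biUnion, card_children_root hG]; simp
    | succ n ih =>
      rw [hstep, Finset.card_biUnion (hdisj _), Finset.sum_const_nat (m := q), ih]
      · ring
      · intro x hx
        have hx' : x ∈ {x | G.dist o x = n + 1} := (Set.Finite.mem_toFinset _).1 hx
        change G.dist o x = n + 1 at hx'
        exact card_children_of_ne hG (by rintro rfl; simp at hx')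
  cases n with
  | zero => rw [h0]; simp
  | succ n => rw [hmain]; simp

/-- The Haar measure `dk` on the compact group `K`, normalised to have total mass one. -/
noncomputable def haarK [G.LocallyFinite] {q : ℕ} (hG : IsHomogeneousTree G q) (o : V) :
    Measure (rootStabilizer G o) :=
  let _ : CompactSpace (rootStabilizer G o) := rootStabilizer_compactSpace hG.isTree.connected
  Measure.haarMeasure ⊤

end Group

/-! ### The boundary and its probability measure -/

/-- The boundary `Ω`: all infinite geodesic rays starting from `o`. -/
structure Boundary (G : SimpleGraph V) (o : V) where
  /-- The successive vertices of the ray. -/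
  vertex : ℕ → V
  vertex_zero : vertex 0 = o
  dist_vertex : ∀ m n, m ≤ n → G.dist (vertex m) (vertex n) = n - m

/-- `confluence x ω` is the vertex `c(x, ω)`, the last point of the geodesic path from `o` to `x`
that lies on `ω`.  A vertex `v` is on this path iff `d(o, v) + d(v, x) = d(o, x)`. -/
noncomputable def confluence {G : SimpleGraph V} {o : V} (x : V) (ω : Boundary G o) : V :=
  ω.vertex (Nat.findGreatest (fun l => G.dist o (ω.vertex l) + G.dist (ω.vertex l) x = G.dist o x) (G.dist o x))

/-- The sectors `E_j(x) = {ω : |c(x, ω)| ≥ j}`. -/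
def sectorAt (G : SimpleGraph V) (o : V) (j : ℕ) (x : V) : Set (Boundary G o) :=
  {ω | j ≤ G.dist o (confluence x ω)}

/-- The sector `E(x) = E_{|x|}(x)`. -/
def sector (G : SimpleGraph V) (o x : V) : Set (Boundary G o) := sectorAt G o (G.dist o x) x

/-- The `σ`-algebra on `Ω` generated by the sectors `E(x)`. -/
instance boundaryMeasurableSpace (G : SimpleGraph V) (o : V) : MeasurableSpace (Boundary G o) :=
  MeasurableSpace.generateFrom (Set.range (sector G o))

/-- The prescribed mass of a sector `E(x)` with `|x| = n`. -/
noncomputable def sectorMass (q n : ℕ) : ℝ≥0∞ :=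
  if n = 0 then 1 else 1 / (((q : ℝ≥0∞) + 1) * (q : ℝ≥0∞) ^ (n - 1))

section Boundary

variable {G : SimpleGraph V} {o : V}

theorem dist_root_ray (ω : Boundary G o) (n : ℕ) : G.dist o (ω.vertex n) = n := by
  have := ω.dist_vertex 0 n (Nat.zero_le n)
  rwa [ω.vertex_zero, Nat.sub_zero] at this

theorem mem_sector (hG : G.Connected) {x : V} {ω : Boundary G o} :
    ω ∈ sector G o x ↔ ω.vertex (G.dist o x) = x := by
  set P : ℕ → Prop := fun l => G.dist o (ω.vertex l) + G.dist (ω.vertex l) x = G.dist o x with hP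
  have h : ω ∈ sector G o x ↔ G.dist o x ≤ Nat.findGreatest P (G.dist o x) := by
    change G.dist o x ≤ G.dist o (ω.vertex (Nat.findGreatest P (G.dist o x))) ↔ _
    rw [dist_root_ray]
  rw [h]
  constructor
  · intro h1
    have h2 := le_antisymm h1 (Nat.findGreatest_le _)
    have h3 : P (G.dist o x) := by
      rcases Nat.eq_zero_or_pos (G.dist o x) with h0 | h0
      · rw [h0, hP]
        simp only [ω.vertex_zero, SimpleGraph.dist_self, zero_add]
      · have := Nat.findGreatest_of_ne_zero (P := P) h2.symm h0.ne'
        exact this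
    have h4 : G.dist o (ω.vertex (G.dist o x)) + G.dist (ω.vertex (G.dist o x)) x = G.dist o x := h3
    rw [dist_root_ray] at h4
    exact hG.dist_eq_zero_iff.1 (by omega)
  · intro h1
    refine Nat.le_findGreatest le_rfl ?_
    change G.dist o (ω.vertex (G.dist o x)) + G.dist (ω.vertex (G.dist o x)) x = G.dist o x
    rw [h1, SimpleGraph.dist_self, add_zero]

/-- The action of `K` on `Ω`. -/
def act (k : rootStabilizer G o) (ω : Boundary G o) : Boundary G o :=
  ⟨fun n => (k : Equiv.Perm V) (ω.vertex n),
    (congrArg (k : Equiv.Perm V) ω.vertex_zero).trans k.2.2,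
    fun m n h => (k.2.1 _ _).trans (ω.dist_vertex m n h)⟩

theorem boundary_nonempty [G.LocallyFinite] {q : ℕ} (hG : IsHomogeneousTree G q) (o : V) :
    Nonempty (Boundary G o) := by
  have hne : ∀ v, ∃ w, w ∈ children G o v := by
    intro v
    have h2 := hG.two_le
    by_cases hv : v = o
    · rw [hv]
      exact Finset.card_pos.1 (by rw [card_children_root hG]; omega)
    · exact Finset.card_pos.1 (by rw [card_children_of_ne hG hv]; omega)
  choose f hf using hne
  have hd : ∀ n, G.dist o (f^[n] o) = n := by
    intro n
    induction n with
    | zero => simp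
    | succ n ih => rw [Function.iterate_succ_apply', (mem_children.1 (hf _)).2, ih]
  have hc := hG.isTree.connected
  have hle : ∀ m i, G.dist (f^[m] o) (f^[m + i] o) ≤ i := by
    intro m i
    induction i with
    | zero => simp
    | succ i ih =>
      have h1 := hc.dist_triangle (u := f^[m] o) (v := f^[m + i] o) (w := f^[m + (i + 1)] o)
      have h2 : G.dist (f^[m + i] o) (f^[m + (i + 1)] o) = 1 := by
        rw [← add_assoc, Function.iterate_succ_apply']
        exact SimpleGraph.dist_eq_one_iff_adj.2 (mem_children.1 (hf _)).1
      omega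
  refine ⟨⟨fun n => f^[n] o, rfl, fun m n hmn => ?_⟩⟩
  obtain ⟨i, rfl⟩ := Nat.exists_eq_add_of_le hmn
  have h1 := hc.dist_triangle (u := o) (v := f^[m] o) (w := f^[m + i] o)
  have h2 := hle m i
  rw [hd, hd] at h1
  change G.dist (f^[m] o) (f^[m + i] o) = _
  omega

theorem haarK_setOf_apply_eq [G.LocallyFinite] {q : ℕ} (hG : IsHomogeneousTree G q) {x y : V}
    (hxy : G.dist o x = G.dist o y) :
    haarK hG o {k | (k : Equiv.Perm V) x = y} = sectorMass q (G.dist o x) := by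
  classical
  have hc := hG.isTree.connected
  let _ : CompactSpace (rootStabilizer G o) := rootStabilizer_compactSpace hc
  change Measure.haarMeasure ⊤ {k : rootStabilizer G o | (k : Equiv.Perm V) x = y} = _
  set μ : Measure (rootStabilizer G o) := Measure.haarMeasure ⊤ with hμ
  have huniv : μ Set.univ = 1 := Measure.haarMeasure_self (K₀ := ⊤)
  have hinv : ∀ z, G.dist o x = G.dist o z → μ {k | (k : Equiv.Perm V) x = z} =
      μ {k | (k : Equiv.Perm V) x = y} := by
    intro z hz
    obtain ⟨k₀, hk₀⟩ := exists_apply_eq hG (hxy.symm.trans hz)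
    rw [← measure_preimage_mul μ k₀ {k | (k : Equiv.Perm V) x = z}]
    congr 1
    ext k
    change (k₀ : Equiv.Perm V) ((k : Equiv.Perm V) x) = z ↔ (k : Equiv.Perm V) x = y
    rw [← hk₀, Equiv.apply_eq_iff_eq]
  have hsum : μ Set.univ = ∑ z ∈ (finite_sphere hc o (G.dist o x)).toFinset,
      μ {k | (k : Equiv.Perm V) x = z} := by
    rw [← measure_biUnion_finset]
    · congr 1
      ext k
      simp only [Set.mem_univ, Set.mem_iUnion, true_iff]
      exact ⟨(k : Equiv.Perm V) x, (Set.Finite.mem_toFinset _).2 (dist_root_apply k x), rfl⟩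
    · intro a _ b _ hab
      refine Set.disjoint_left.2 fun k ha hb => hab ?_
      exact (show (k : Equiv.Perm V) x = a from ha).symm.trans hb
    · exact fun z _ => (isOpen_setOf_apply_eq x z).measurableSet
  rw [Finset.sum_congr rfl (g := fun _ => μ {k | (k : Equiv.Perm V) x = y})
    (fun z hz => hinv z ((Set.Finite.mem_toFinset _).1 hz :).symm),
    Finset.sum_const, card_sphere hG, huniv, nsmul_eq_mul] at hsum
  have h3 : μ {k | (k : Equiv.Perm V) x = y} =
      1 / ((if G.dist o x = 0 then 1 else (q + 1) * q ^ (G.dist o x - 1) : ℕ) : ℝ≥0∞) := by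
    refine (ENNReal.eq_div_iff ?_ (ENNReal.natCast_ne_top _)).2 hsum.symm
    have := hG.two_le
    split_ifs <;> positivity
  rw [h3, sectorMass]
  split_ifs <;> simp

/-- There is a measure on `Ω` with the prescribed masses of the sectors. -/
theorem exists_boundaryMeasure [G.LocallyFinite] {q : ℕ} (hG : IsHomogeneousTree G q) (o : V) :
    ∃ ν : Measure (Boundary G o), ∀ x, ν (sector G o x) = sectorMass q (G.dist o x) := by
  obtain ⟨ω⟩ := boundary_nonempty hG o
  have hpre : ∀ x, (fun k => act k ω) ⁻¹' sector G o x =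
      {k : rootStabilizer G o | (k : Equiv.Perm V) (ω.vertex (G.dist o x)) = x} := fun x => by
    ext k
    exact mem_sector hG.isTree.connected
  have hmeas : Measurable fun k : rootStabilizer G o => act k ω := by
    refine measurable_generateFrom ?_
    rintro _ ⟨x, rfl⟩
    rw [hpre]
    exact (isOpen_setOf_apply_eq _ _).measurableSet
  refine ⟨(haarK hG o).map fun k => act k ω, fun x => ?_⟩
  rw [Measure.map_apply hmeas (MeasurableSpace.measurableSet_generateFrom ⟨x, rfl⟩), hpre,
    haarK_setOf_apply_eq hG (dist_root_ray ω _), dist_root_ray]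

/-- The probability measure `ν` on `Ω`, determined by its values on the sectors `E(x)`. -/
noncomputable def boundaryMeasure [G.LocallyFinite] {q : ℕ} (hG : IsHomogeneousTree G q) (o : V) :
    Measure (Boundary G o) :=
  (exists_boundaryMeasure hG o).choose

theorem boundaryMeasure_sector [G.LocallyFinite] {q : ℕ} (hG : IsHomogeneousTree G q) (o x : V) :
    boundaryMeasure hG o (sector G o x) = sectorMass q (G.dist o x) :=
  (exists_boundaryMeasure hG o).choose_spec x

end Boundary

/-! ### Laplacian, Poisson transform, Harish-Chandra function, Hardy-type spaces -/

section Analysis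

variable {G : SimpleGraph V} {o : V}

/-- `τ = 2π / log q`. -/
noncomputable def tau (q : ℕ) : ℝ := 2 * Real.pi / Real.log q

/-- The Laplacian `ℒ` of a homogeneous tree of degree `q + 1`. -/
noncomputable def laplacian (G : SimpleGraph V) [G.LocallyFinite] (q : ℕ) (u : V → ℂ) (x : V) : ℂ :=
  u x - 1 / ((q : ℂ) + 1) * ∑ y ∈ G.neighborFinset x, u y

/-- The eigenvalue `γ(z) = 1 - (q^{1/2+iz} + q^{1/2-iz}) / (q + 1)`. -/
noncomputable def eigenvalue (q : ℕ) (z : ℂ) : ℂ :=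
  1 - ((q : ℂ) ^ (1 / 2 + Complex.I * z) + (q : ℂ) ^ (1 / 2 - Complex.I * z)) / ((q : ℂ) + 1)

/-- The Harish-Chandra `c`-function. -/
noncomputable def cFunction (q : ℕ) (z : ℂ) : ℂ :=
  (q : ℂ) ^ (1 / 2 : ℂ) / ((q : ℂ) + 1) *
    (((q : ℂ) ^ (1 / 2 + Complex.I * z) - (q : ℂ) ^ (-(1 / 2) - Complex.I * z)) /
      ((q : ℂ) ^ (Complex.I * z) - (q : ℂ) ^ (-(Complex.I * z))))

/-- The Poisson kernel `p(x, ω) = q^{2|c(x, ω)| - |x|}`. -/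
noncomputable def poissonKernel (q : ℕ) (x : V) (ω : Boundary G o) : ℝ :=
  (q : ℝ) ^ (2 * (G.dist o (confluence x ω) : ℤ) - (G.dist o x : ℤ))

/-- The Poisson transform `𝒫_z F (x) = ∫_Ω p(x, ω)^{1/2+iz} F(ω) dν(ω)`. -/
noncomputable def poissonTransform [G.LocallyFinite] {q : ℕ} (hG : IsHomogeneousTree G q) (o : V)
    (z : ℂ) (F : Boundary G o → ℂ) (x : V) : ℂ :=
  ∫ ω, (poissonKernel q x ω : ℂ) ^ (1 / 2 + Complex.I * z) * F ω ∂(boundaryMeasure hG o)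

/-- The norm `‖u‖ = sup_n q^{n/2} (∫_K |u(k · ω_n)|^r dk)^{1/r}` of `ℋ^r_*`, with values in
`[0, ∞]`, where `ω₀ = (ω_0, ω_1, …)` is the reference boundary point. -/
noncomputable def hardyNorm [G.LocallyFinite] {q : ℕ} (hG : IsHomogeneousTree G q)
    (ω₀ : Boundary G o) (r : ℝ) (u : V → ℂ) : ℝ≥0∞ :=
  ⨆ n : ℕ, (q : ℝ≥0∞) ^ ((n : ℝ) / 2) *
    (∫⁻ k : rootStabilizer G o, ‖u ((k : Equiv.Perm V) (ω₀.vertex n))‖ₑ ^ r ∂(haarK hG o)) ^ (1 / r)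

/-- The Hardy-type space `ℋ^r_*`. -/
def hardySpace [G.LocallyFinite] {q : ℕ} (hG : IsHomogeneousTree G q)
    (ω₀ : Boundary G o) (r : ℝ) : Set (V → ℂ) :=
  {u | hardyNorm hG ω₀ r u < ∞}

end Analysis

end HomTree

/-! View Ω as a probability space filtered by the successive vertices of a random ray. The averages
f of F over the sectors form a martingale. Put Q = q^{1/2+iz}, w = q^{2iz}, c = 𝐜(z) and v(x) =
Q^{|x|} 𝒫_zF(x). Passing from x to a child y changes the normalized Poisson kernel only on E(y),
whence v(o) = f(o) and v(y) − v(x) = c(w − 1) w^{|x|} f(y) (`isPoissonPair_poissonTransform`). For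
real z one has |w| = 1 and |Q| = q^{1/2}, so the Hardy norm of 𝒫_zF is the supremum over n of the
L^r norms of v on spheres (`hardyNorm_eq_iSup`).

Upper bound. Along a ray, summation by parts gives v_n = (1 − c) f_0 + c w^n f_n − c g_n, where g_n
is the sum over k < n of w^k (f_{k+1} − f_k). Here g is a martingale transform of f by unimodular
coefficients, so Burkholder's inequality bounds it with a constant depending only on r; moreover |1
− c| = |c|. Burkholder's inequality is proved with an explicit Bellman function (`exists_isBellman`,
`exists_levelNorm_transform_le`).

Lower bound. Conditioning v_{n+k} on level n gives v_n + c(w^{n+k} − w^n) f_n. Multiply by w^{-k}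
and average over k < N: since w ≠ 1, the geometric sums stay bounded and only c w^n f_n survives as
N → ∞. Conditional expectation contracts L^r, so |c| ‖f_n‖_r is at most the Hardy norm
(`IsPoissonPair.mul_levelNorm_le`). Then n → ∞, and the constant 1 works.

Characterization. For an eigenfunction u, divide the increments of v = Q^{|x|} u by c(w − 1)
w^{|x|}. The eigenvalue equation away from o says exactly that the quotients form a martingale f; it
is bounded in L^r, hence comes from some F in L^r because r > 1. Then v and the normalized transform
of F differ by a constant, which the equation at o forces to vanish (`exists_eq_poissonTransform`).
-/

namespace HomTree

/-! ### Bellman functions for Burkholder's inequality -/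

section Bellman

theorem le_tangent_of_deriv2_nonpos {f f' f'' : ℝ → ℝ} (h1 : ∀ t, HasDerivAt f (f' t) t)
    (h2 : ∀ t, HasDerivAt f' (f'' t) t) (h3 : ∀ t, f'' t ≤ 0) : f 1 ≤ f 0 + f' 0 := by
  have hanti : Antitone f' := antitone_of_deriv_nonpos (fun t => (h2 t).differentiableAt)
    fun t => by rw [(h2 t).deriv]; exact h3 t
  obtain ⟨c, hc, hc'⟩ := exists_hasDerivAt_eq_slope f f' (zero_lt_one' ℝ)
    (fun t _ => (h1 t).continuousAt.continuousWithinAt) fun t _ => h1 t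
  have h4 := hanti hc.1.le
  rw [hc', sub_zero, div_one] at h4
  linarith

theorem hasDerivAt_quadratic (α β γ t : ℝ) :
    HasDerivAt (fun t => α + β * t + γ * t ^ 2) (β + 2 * γ * t) t := by
  have h := (((hasDerivAt_id t).const_mul β).const_add α).add ((hasDerivAt_pow 2 t).const_mul γ)
  refine h.congr_deriv ?_
  simp
  ring

theorem hasDerivAt_quadratic_rpow (α β γ κ t : ℝ) (h : 0 < α + β * t + γ * t ^ 2) :
    HasDerivAt (fun t => (α + β * t + γ * t ^ 2) ^ κ)
      ((β + 2 * γ * t) * κ * (α + β * t + γ * t ^ 2) ^ (κ - 1)) t :=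
  (hasDerivAt_quadratic α β γ t).rpow_const (Or.inl h.ne')

theorem hasDerivAt_deriv_quadratic_rpow (α β γ κ t : ℝ) (h : 0 < α + β * t + γ * t ^ 2) :
    HasDerivAt (fun t => (β + 2 * γ * t) * κ * (α + β * t + γ * t ^ 2) ^ (κ - 1))
      (κ * (2 * γ * (α + β * t + γ * t ^ 2) +
        (κ - 1) * (β + 2 * γ * t) ^ 2) * (α + β * t + γ * t ^ 2) ^ (κ - 2)) t := by
  have h1 : HasDerivAt (fun t => (β + 2 * γ * t) * κ) (2 * γ * κ) t := by
    have := (((hasDerivAt_id t).const_mul (2 * γ)).const_add β).mul_const κ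
    simpa using this
  refine (h1.mul (hasDerivAt_quadratic_rpow α β γ (κ - 1) t h)).congr_deriv ?_
  have h2 : (α + β * t + γ * t ^ 2) ^ (κ - 1) =
      (α + β * t + γ * t ^ 2) ^ (κ - 2) * (α + β * t + γ * t ^ 2) := by
    rw [← Real.rpow_add_one h.ne']; congr 1; ring
  have h3 : κ - 1 - 1 = κ - 2 := by ring
  rw [h3, h2]
  ring

/-- In the application the quadratics are s(t) = ε + ‖x + th‖² and a(t) = s(t) + ‖y + tk‖². The
second derivative of a^κ is at most 2κγ' a^{κ-1} ≤ 4κγ s^{κ-1}, while that of s^κ is at least κ(4κ −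
2)γ s^{κ-1}. The factor 1/(κ − 1/2) balances the two, so the difference is concave in t and lies
below its tangent. -/
theorem rpow_quadratic_tangent_of_le_one {κ α β γ α' β' γ' : ℝ} (hκ : 1 / 2 < κ) (hκ' : κ ≤ 1)
    (hs : ∀ t, 0 < α + β * t + γ * t ^ 2)
    (hle : ∀ t, α + β * t + γ * t ^ 2 ≤ α' + β' * t + γ' * t ^ 2)
    (hdisc : β ^ 2 ≤ 4 * α * γ) (hγ : 0 ≤ γ) (hγ' : γ' ≤ 2 * γ) :
    (α' + β' + γ') ^ κ - (κ - 1 / 2)⁻¹ * (α + β + γ) ^ κ ≤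
      α' ^ κ - (κ - 1 / 2)⁻¹ * α ^ κ +
        (β' * κ * α' ^ (κ - 1) - (κ - 1 / 2)⁻¹ * (β * κ * α ^ (κ - 1))) := by
  set C := (κ - 1 / 2)⁻¹ with hC
  have hC1 : C * (κ - 1 / 2) = 1 := inv_mul_cancel₀ (by linarith)
  have hC0 : 0 < C := inv_pos.2 (by linarith)
  have ha : ∀ t, 0 < α' + β' * t + γ' * t ^ 2 := fun t => (hs t).trans_le (hle t)
  have key := le_tangent_of_deriv2_nonpos
    (fun t => (hasDerivAt_quadratic_rpow α' β' γ' κ t (ha t)).sub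
      ((hasDerivAt_quadratic_rpow α β γ κ t (hs t)).const_mul C))
    (fun t => (hasDerivAt_deriv_quadratic_rpow α' β' γ' κ t (ha t)).sub
      ((hasDerivAt_deriv_quadratic_rpow α β γ κ t (hs t)).const_mul C)) ?_
  · simpa using key
  intro t
  set s := α + β * t + γ * t ^ 2
  set a := α' + β' * t + γ' * t ^ 2
  have hs0 : 0 < s := hs t
  have ha0 : 0 < a := ha t
  have e1 : ∀ x : ℝ, 0 < x → x * x ^ (κ - 2) = x ^ (κ - 1) := fun x hx => by
    rw [mul_comm, ← Real.rpow_add_one hx.ne']; congr 1; ring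
  have h1 : κ * (2 * γ' * a + (κ - 1) * (β' + 2 * γ' * t) ^ 2) * a ^ (κ - 2) ≤
      κ * (4 * γ) * s ^ (κ - 1) := by
    have h2 : κ * (2 * γ' * a + (κ - 1) * (β' + 2 * γ' * t) ^ 2) * a ^ (κ - 2) ≤
        κ * (2 * γ' * a) * a ^ (κ - 2) := by
      have := mul_nonneg (sub_nonneg.2 hκ') (sq_nonneg (β' + 2 * γ' * t))
      gcongr
      nlinarith
    have h3 : κ * (2 * γ' * a) * a ^ (κ - 2) = κ * (2 * γ') * a ^ (κ - 1) := by
      rw [← e1 a ha0]; ring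
    have h4 : a ^ (κ - 1) ≤ s ^ (κ - 1) :=
      Real.rpow_le_rpow_of_nonpos hs0 (hle t) (by linarith)
    rw [h3] at h2
    refine h2.trans ?_
    have : 0 ≤ κ := by linarith
    gcongr κ * ?_ * ?_
    linarith
  have h5 : κ * (4 * γ) * s ^ (κ - 1) ≤
      C * (κ * (2 * γ * s + (κ - 1) * (β + 2 * γ * t) ^ 2) * s ^ (κ - 2)) := by
    -- (s')² = 4γs + (β² − 4αγ), and the discriminant is nonpositive.
    have h6 : (β + 2 * γ * t) ^ 2 ≤ 4 * γ * s := by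
      change _ ≤ 4 * γ * (α + β * t + γ * t ^ 2)
      nlinarith
    have h7 : (4 * κ - 2) * γ * s ≤ 2 * γ * s + (κ - 1) * (β + 2 * γ * t) ^ 2 := by
      nlinarith
    have h8 : C * (κ * ((4 * κ - 2) * γ * s) * s ^ (κ - 2)) ≤
        C * (κ * (2 * γ * s + (κ - 1) * (β + 2 * γ * t) ^ 2) * s ^ (κ - 2)) := by
      have : 0 ≤ κ := by linarith
      gcongr
    refine le_trans (le_of_eq ?_) h8
    rw [← e1 s hs0]
    linear_combination (-4 * κ * γ * s * s ^ (κ - 2)) * hC1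
  linarith

/-- For κ ≥ 1 the roles are exchanged: with b the unprimed and a the primed quadratic, the second
derivative of b^κ is at most κ(4κ − 2)γ b^{κ-1}, and that of a^κ is at least 2κγ' a^{κ-1} ≥ 2κγ
δ^{κ-1} b^{κ-1}. The relation between C and δ makes the second, times C, absorb the first. -/
theorem rpow_quadratic_tangent_of_one_le {κ δ C α β γ α' β' γ' : ℝ} (hκ : 1 ≤ κ) (hδ : 0 < δ)
    (hC : C * δ ^ (κ - 1) = 2 * κ - 1) (hb : ∀ t, 0 < α + β * t + γ * t ^ 2)
    (hle : ∀ t, δ * (α + β * t + γ * t ^ 2) ≤ α' + β' * t + γ' * t ^ 2)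
    (hdisc : β ^ 2 ≤ 4 * α * γ) (hγ : 0 ≤ γ) (hγ' : γ ≤ γ') :
    (α + β + γ) ^ κ - C * (α' + β' + γ') ^ κ ≤
      α ^ κ - C * α' ^ κ + (β * κ * α ^ (κ - 1) - C * (β' * κ * α' ^ (κ - 1))) := by
  have hδκ : 0 < δ ^ (κ - 1) := Real.rpow_pos_of_pos hδ _
  have hC0 : 0 ≤ C := by
    by_contra h
    have := mul_neg_of_neg_of_pos (not_le.1 h) hδκ
    linarith
  have ha : ∀ t, 0 < α' + β' * t + γ' * t ^ 2 := fun t => (mul_pos hδ (hb t)).trans_le (hle t)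
  have key := le_tangent_of_deriv2_nonpos
    (fun t => (hasDerivAt_quadratic_rpow α β γ κ t (hb t)).sub
      ((hasDerivAt_quadratic_rpow α' β' γ' κ t (ha t)).const_mul C))
    (fun t => (hasDerivAt_deriv_quadratic_rpow α β γ κ t (hb t)).sub
      ((hasDerivAt_deriv_quadratic_rpow α' β' γ' κ t (ha t)).const_mul C)) ?_
  · simpa using key
  intro t
  set b := α + β * t + γ * t ^ 2
  set a := α' + β' * t + γ' * t ^ 2
  have hb0 : 0 < b := hb t
  have ha0 : 0 < a := ha t
  have e1 : ∀ x : ℝ, 0 < x → x * x ^ (κ - 2) = x ^ (κ - 1) := fun x hx => by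
    rw [mul_comm, ← Real.rpow_add_one hx.ne']; congr 1; ring
  have h1 : κ * (2 * γ * b + (κ - 1) * (β + 2 * γ * t) ^ 2) * b ^ (κ - 2) ≤
      κ * ((4 * κ - 2) * γ) * b ^ (κ - 1) := by
    have h6 : (β + 2 * γ * t) ^ 2 ≤ 4 * γ * b := by
      change _ ≤ 4 * γ * (α + β * t + γ * t ^ 2)
      nlinarith
    have h7 : 2 * γ * b + (κ - 1) * (β + 2 * γ * t) ^ 2 ≤ (4 * κ - 2) * γ * b := by
      nlinarith
    have h8 : κ * (2 * γ * b + (κ - 1) * (β + 2 * γ * t) ^ 2) * b ^ (κ - 2) ≤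
        κ * ((4 * κ - 2) * γ * b) * b ^ (κ - 2) := by
      gcongr
    refine h8.trans (le_of_eq ?_)
    rw [← e1 b hb0]
    ring
  have h2 : κ * ((4 * κ - 2) * γ) * b ^ (κ - 1) ≤
      C * (κ * (2 * γ' * a + (κ - 1) * (β' + 2 * γ' * t) ^ 2) * a ^ (κ - 2)) := by
    have h3 : C * (κ * (2 * γ' * a) * a ^ (κ - 2)) ≤
        C * (κ * (2 * γ' * a + (κ - 1) * (β' + 2 * γ' * t) ^ 2) * a ^ (κ - 2)) := by
      have := mul_nonneg (sub_nonneg.2 hκ) (sq_nonneg (β' + 2 * γ' * t))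
      gcongr
      linarith
    refine le_trans ?_ h3
    have h4 : C * (κ * (2 * γ' * a) * a ^ (κ - 2)) = C * (κ * (2 * γ') * a ^ (κ - 1)) := by
      rw [← e1 a ha0]; ring
    have h5 : (δ * b) ^ (κ - 1) ≤ a ^ (κ - 1) :=
      Real.rpow_le_rpow (mul_pos hδ hb0).le (hle t) (by linarith)
    rw [Real.mul_rpow hδ.le hb0.le] at h5
    have h6 : C * (κ * (2 * γ) * (δ ^ (κ - 1) * b ^ (κ - 1))) ≤
        C * (κ * (2 * γ') * a ^ (κ - 1)) := by
      have : 0 ≤ κ * (2 * γ') := mul_nonneg (by linarith) (by linarith)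
      gcongr
    rw [h4]
    refine le_trans (le_of_eq ?_) h6
    linear_combination (-2 * κ * γ * b ^ (κ - 1)) * hC
  linarith

theorem norm_add_smul_sq (x h : ℂ) (t : ℝ) :
    ‖x + t • h‖ ^ 2 = ‖x‖ ^ 2 + 2 * inner ℝ x h * t + ‖h‖ ^ 2 * t ^ 2 := by
  rw [norm_add_sq_real, inner_smul_right, norm_smul, mul_pow, Real.norm_eq_abs, sq_abs]
  ring

theorem norm_add_sq_quadratic (x h : ℂ) :
    ‖x + h‖ ^ 2 = ‖x‖ ^ 2 + 2 * inner ℝ x h + ‖h‖ ^ 2 := norm_add_sq_real x h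

theorem inner_sq_le (x h : ℂ) : (inner ℝ x h : ℝ) ^ 2 ≤ ‖x‖ ^ 2 * ‖h‖ ^ 2 := by
  rw [← mul_pow, ← sq_abs]
  exact pow_le_pow_left₀ (abs_nonneg _) (abs_real_inner_le_norm x h) 2

theorem norm_rpow_eq_sq_rpow (x : ℂ) (r : ℝ) : ‖x‖ ^ r = (‖x‖ ^ 2) ^ (r / 2) := by
  rw [← Real.rpow_natCast, ← Real.rpow_mul (norm_nonneg x)]
  congr 1
  push_cast
  ring

/-- A function `U` on `ℂ × ℂ` that is concave in the directions `(h, k)` with `‖k‖ ≤ ‖h‖` and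
majorizes `‖y‖ ^ r - C ‖x‖ ^ r`, up to a small error. -/
def IsBellman (r C η : ℝ) (U : ℂ → ℂ → ℝ) : Prop :=
  (∀ x y, ‖y‖ ^ r ≤ C * ‖x‖ ^ r + U x y + η) ∧ (∀ x, U x 0 ≤ η) ∧
    ∀ x y, ∃ L : ℂ × ℂ →ₗ[ℝ] ℝ, ∀ h k, ‖k‖ ≤ ‖h‖ → U (x + h) (y + k) ≤ U x y + L (h, k)

/-- The function is (ε + ‖x‖² + ‖y‖²)^κ − C(ε + ‖x‖²)^κ with κ = r/2. The shift ε keeps the bases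
positive, hence the powers smooth at the origin; it costs only the error η, by subadditivity of t ↦
t^κ. -/
theorem exists_isBellman_of_le_two {r : ℝ} (hr : 1 < r) (hr' : r ≤ 2) :
    ∃ C, 0 ≤ C ∧ ∀ η, 0 < η → ∃ U, IsBellman r C η U := by
  set κ := r / 2 with hκ
  have h1 : 1 / 2 < κ := by linarith
  have h2 : κ ≤ 1 := by linarith
  set C := (κ - 1 / 2)⁻¹ with hC
  have hC0 : 0 < C := inv_pos.2 (by linarith)
  have hC1 : 1 ≤ C := (one_le_inv₀ (by linarith)).2 (by linarith)
  refine ⟨C, hC0.le, fun η hη => ?_⟩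
  obtain ⟨ε, hε, hεη⟩ : ∃ ε : ℝ, 0 < ε ∧ C * ε ^ κ = η := by
    refine ⟨(η / C) ^ κ⁻¹, by positivity, ?_⟩
    rw [Real.rpow_inv_rpow (by positivity) (by linarith)]
    field_simp
  refine ⟨fun x y => (ε + ‖x‖ ^ 2 + ‖y‖ ^ 2) ^ κ - C * (ε + ‖x‖ ^ 2) ^ κ, fun x y => ?_,
    fun x => ?_, fun x y => ?_⟩
  · rw [norm_rpow_eq_sq_rpow, norm_rpow_eq_sq_rpow x, ← hκ, ← hεη]
    have h3 := Real.rpow_add_le_add_rpow hε.le (sq_nonneg ‖x‖) (by linarith : 0 ≤ κ) h2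
    have h4 : (‖y‖ ^ 2) ^ κ ≤ (ε + ‖x‖ ^ 2 + ‖y‖ ^ 2) ^ κ :=
      Real.rpow_le_rpow (by positivity) (by nlinarith [sq_nonneg ‖x‖]) (by linarith)
    nlinarith
  · have : 0 ≤ (ε + ‖x‖ ^ 2) ^ κ := by positivity
    simp only [norm_zero, ne_eq, OfNat.ofNat_ne_zero, not_false_eq_true, zero_pow, add_zero]
    nlinarith
  -- The functional is the real differential of U at (x, y).
  · refine ⟨((2 * κ * (ε + ‖x‖ ^ 2 + ‖y‖ ^ 2) ^ (κ - 1) - C * (2 * κ * (ε + ‖x‖ ^ 2) ^ (κ - 1))) •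
      innerₛₗ ℝ x) ∘ₗ LinearMap.fst ℝ ℂ ℂ +
      ((2 * κ * (ε + ‖x‖ ^ 2 + ‖y‖ ^ 2) ^ (κ - 1)) • innerₛₗ ℝ y) ∘ₗ LinearMap.snd ℝ ℂ ℂ,
      fun h k hk => ?_⟩
    have hk2 : ‖k‖ ^ 2 ≤ ‖h‖ ^ 2 := pow_le_pow_left₀ (norm_nonneg _) hk 2
    have key := rpow_quadratic_tangent_of_le_one (κ := κ) (α := ε + ‖x‖ ^ 2)
      (β := 2 * inner ℝ x h) (γ := ‖h‖ ^ 2) (α' := ε + ‖x‖ ^ 2 + ‖y‖ ^ 2)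
      (β' := 2 * inner ℝ x h + 2 * inner ℝ y k) (γ' := ‖h‖ ^ 2 + ‖k‖ ^ 2) h1 h2
      (fun t => ?_) (fun t => ?_) ?_ (by positivity) (by linarith)
    · simp only [norm_add_sq_quadratic, LinearMap.add_apply, LinearMap.comp_apply,
        LinearMap.fst_apply, LinearMap.snd_apply, LinearMap.smul_apply, innerₛₗ_apply_apply,
        smul_eq_mul]
      rw [← hC] at key
      refine le_trans (le_of_eq ?_) (key.trans (le_of_eq ?_))
      · ring_nf
      · ring
    · have := norm_add_smul_sq x h t
      nlinarith [sq_nonneg ‖x + t • h‖]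
    · have := norm_add_smul_sq y k t
      nlinarith [sq_nonneg ‖y + t • k‖]
    · have := inner_sq_le x h
      nlinarith [mul_nonneg hε.le (sq_nonneg ‖h‖)]

theorem rpow_add_le_two_rpow_mul {a b κ : ℝ} (ha : 0 ≤ a) (hb : 0 ≤ b) (hκ : 1 ≤ κ) :
    (a + b) ^ κ ≤ 2 ^ (κ - 1) * (a ^ κ + b ^ κ) := by
  lift a to NNReal using ha
  lift b to NNReal using hb
  exact_mod_cast NNReal.rpow_add_le_mul_rpow_add_rpow a b hκ

/-- The function is 2((ε + ‖y‖²)^κ − C(‖x‖² + δ(ε + ‖y‖²))^κ). The term with δ makes the subtracted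
base dominate a multiple of ε + ‖y‖², as the comparison of second derivatives needs. -/
theorem exists_isBellman_of_two_le {r : ℝ} (hr : 2 ≤ r) :
    ∃ C, 0 ≤ C ∧ ∀ η, 0 < η → ∃ U, IsBellman r C η U := by
  set κ := r / 2 with hκ
  have h1 : 1 ≤ κ := by linarith
  -- Two conditions fix δ and C: concavity asks for C δ^{κ-1} = 2κ − 1, and the majorization asks
  -- for C 2^{κ-1} δ^κ = 1/2, so that half of (ε + ‖y‖²)^κ remains. The overall factor 2 in U
  -- restores that half.
  set δ : ℝ := ((2 * κ - 1) * 2 ^ κ)⁻¹ with hδ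
  have hδ0 : 0 < δ := inv_pos.2 (mul_pos (by linarith) (by positivity))
  set C := (2 * κ - 1) * (δ ^ (κ - 1))⁻¹ with hC
  have hδκ : 0 < δ ^ (κ - 1) := Real.rpow_pos_of_pos hδ0 _
  have hC0 : 0 < C := mul_pos (by linarith) (inv_pos.2 hδκ)
  have hC1 : C * δ ^ (κ - 1) = 2 * κ - 1 := by rw [hC]; field_simp
  have hC2 : C * 2 ^ (κ - 1) * δ ^ κ = 1 / 2 := by
    have e1 : δ ^ κ = δ ^ (κ - 1) * δ := by rw [← Real.rpow_add_one hδ0.ne']; congr 1; ring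
    have e2 : (2 : ℝ) ^ κ = 2 ^ (κ - 1) * 2 := by
      rw [← Real.rpow_add_one two_ne_zero]; congr 1; ring
    have e3 : δ * ((2 * κ - 1) * 2 ^ κ) = 1 :=
      inv_mul_cancel₀ (mul_pos (by linarith) (by positivity)).ne'
    rw [e2] at e3
    rw [e1]
    linear_combination (2 ^ (κ - 1) * δ) * hC1 + e3 / 2
  refine ⟨2 * (C * 2 ^ (κ - 1)), by positivity, fun η hη => ?_⟩
  obtain ⟨ε, hε, hεη⟩ : ∃ ε : ℝ, 0 < ε ∧ 2 * ε ^ κ = η := by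
    refine ⟨(η / 2) ^ κ⁻¹, by positivity, ?_⟩
    rw [Real.rpow_inv_rpow (by positivity) (by linarith)]
    field_simp
  refine ⟨fun x y => 2 * ((ε + ‖y‖ ^ 2) ^ κ - C * (‖x‖ ^ 2 + δ * (ε + ‖y‖ ^ 2)) ^ κ),
    fun x y => ?_, fun x => ?_, fun x y => ?_⟩
  · rw [norm_rpow_eq_sq_rpow, norm_rpow_eq_sq_rpow x, ← hκ]
    have h3 := rpow_add_le_two_rpow_mul (a := ‖x‖ ^ 2) (b := δ * (ε + ‖y‖ ^ 2))
      (by positivity) (by positivity) h1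
    rw [Real.mul_rpow hδ0.le (by positivity)] at h3
    have h4 : (‖y‖ ^ 2) ^ κ ≤ (ε + ‖y‖ ^ 2) ^ κ :=
      Real.rpow_le_rpow (by positivity) (by linarith) (by linarith)
    have h5 := mul_le_mul_of_nonneg_left h3 hC0.le
    have h6 : C * (2 ^ (κ - 1) * ((‖x‖ ^ 2) ^ κ + δ ^ κ * (ε + ‖y‖ ^ 2) ^ κ)) =
        C * 2 ^ (κ - 1) * (‖x‖ ^ 2) ^ κ + 1 / 2 * (ε + ‖y‖ ^ 2) ^ κ := by
      linear_combination ((ε + ‖y‖ ^ 2) ^ κ) * hC2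
    rw [h6] at h5
    linarith
  · simp only [norm_zero, ne_eq, OfNat.ofNat_ne_zero, not_false_eq_true, zero_pow, add_zero]
    have : 0 ≤ C * (‖x‖ ^ 2 + δ * ε) ^ κ := by positivity
    linarith
  · refine ⟨(-(2 * (C * (2 * κ * (‖x‖ ^ 2 + δ * (ε + ‖y‖ ^ 2)) ^ (κ - 1)))) • innerₛₗ ℝ x) ∘ₗ
      LinearMap.fst ℝ ℂ ℂ + ((2 * (2 * κ * (ε + ‖y‖ ^ 2) ^ (κ - 1) -
        C * (δ * (2 * κ * (‖x‖ ^ 2 + δ * (ε + ‖y‖ ^ 2)) ^ (κ - 1))))) • innerₛₗ ℝ y) ∘ₗ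
      LinearMap.snd ℝ ℂ ℂ, fun h k hk => ?_⟩
    have hk2 : ‖k‖ ^ 2 ≤ ‖h‖ ^ 2 := pow_le_pow_left₀ (norm_nonneg _) hk 2
    have key := rpow_quadratic_tangent_of_one_le (κ := κ) (δ := δ) (C := C) (α := ε + ‖y‖ ^ 2)
      (β := 2 * inner ℝ y k) (γ := ‖k‖ ^ 2) (α' := ‖x‖ ^ 2 + δ * (ε + ‖y‖ ^ 2))
      (β' := 2 * inner ℝ x h + δ * (2 * inner ℝ y k)) (γ' := ‖h‖ ^ 2 + δ * ‖k‖ ^ 2) h1 hδ0 hC1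
      (fun t => ?_) (fun t => ?_) ?_ (by positivity) ?_
    · simp only [norm_add_sq_quadratic, LinearMap.add_apply, LinearMap.comp_apply,
        LinearMap.fst_apply, LinearMap.snd_apply, LinearMap.smul_apply, innerₛₗ_apply_apply,
        smul_eq_mul]
      refine le_trans (le_of_eq ?_) ((mul_le_mul_of_nonneg_left key zero_le_two).trans
        (le_of_eq ?_))
      · ring_nf
      · ring
    · have := norm_add_smul_sq y k t
      nlinarith [sq_nonneg ‖y + t • k‖]
    · have := norm_add_smul_sq x h t
      nlinarith [sq_nonneg ‖x + t • h‖]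
    · have := inner_sq_le y k
      nlinarith [mul_nonneg hε.le (sq_nonneg ‖k‖)]
    · nlinarith [mul_nonneg hδ0.le (sq_nonneg ‖k‖)]

theorem exists_isBellman {r : ℝ} (hr : 1 < r) :
    ∃ C, 0 ≤ C ∧ ∀ η, 0 < η → ∃ U, IsBellman r C η U :=
  (le_total r 2).elim (exists_isBellman_of_le_two hr) exists_isBellman_of_two_le

end Bellman

/-! ### Parents, sectors and the Poisson kernel along an edge -/

section Rays

variable {V : Type*} {G : SimpleGraph V} {o : V}

/-- The neighbour of `x` that is closer to `o` (with the convention that the parent of `o` is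
`o`). -/
noncomputable def parent (hG : G.Connected) (o x : V) : V :=
  open Classical in if hx : x ≠ o then (exists_parent hG o hx).choose else o

theorem parent_eq [G.LocallyFinite] (hG : G.IsTree) {x y : V} (hy : y ∈ children G o x) :
    parent hG.connected o y = x := by
  have hy' := mem_children.1 hy
  have hyo : y ≠ o := by
    rintro rfl
    simp at hy'
  rw [parent, dif_pos hyo]
  have h := (exists_parent hG.connected o hyo).choose_spec
  exact parent_unique hG o h.1 h.2 hy'.1 hy'.2.symm

theorem mem_children_parent [G.LocallyFinite] (hG : G.Connected) {x : V} (hx : x ≠ o) :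
    x ∈ children G o (parent hG o x) := by
  rw [parent, dif_pos hx]
  have h := (exists_parent hG o hx).choose_spec
  exact mem_children.2 ⟨h.1, h.2.symm⟩

theorem vertex_succ_mem_children [G.LocallyFinite] (ω : Boundary G o) (n : ℕ) :
    ω.vertex (n + 1) ∈ children G o (ω.vertex n) := by
  rw [mem_children, dist_root_ray, dist_root_ray]
  refine ⟨SimpleGraph.dist_eq_one_iff_adj.1 ?_, rfl⟩
  rw [ω.dist_vertex _ _ n.le_succ]
  simp

theorem parent_vertex_succ [G.LocallyFinite] (hG : G.IsTree) (ω : Boundary G o) (n : ℕ) :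
    parent hG.connected o (ω.vertex (n + 1)) = ω.vertex n :=
  parent_eq hG (vertex_succ_mem_children ω n)

theorem dist_of_mem_children [G.LocallyFinite] {x y : V} (hy : y ∈ children G o x) :
    G.dist o y = G.dist o x + 1 := (mem_children.1 hy).2

theorem sector_subset_of_mem_children [G.LocallyFinite] (hG : G.IsTree) {x y : V}
    (hy : y ∈ children G o x) : sector G o y ⊆ sector G o x := by
  intro ω hω
  rw [mem_sector hG.connected] at hω ⊢
  rw [dist_of_mem_children hy] at hω
  rw [← parent_vertex_succ hG, hω, parent_eq hG hy]

theorem sector_root (hG : G.Connected) : sector G o o = Set.univ := by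
  ext ω
  simp [mem_sector hG, ω.vertex_zero]

theorem sector_disjoint (hG : G.Connected) {x y : V} (hxy : G.dist o x = G.dist o y)
    (hne : x ≠ y) : Disjoint (sector G o x) (sector G o y) := by
  refine Set.disjoint_left.2 fun ω h1 h2 => hne ?_
  rw [mem_sector hG] at h1 h2
  rw [← h1, ← h2, hxy]

theorem sector_eq_biUnion [G.LocallyFinite] (hG : G.IsTree) (x : V) :
    sector G o x = ⋃ y ∈ children G o x, sector G o y := by
  refine Set.Subset.antisymm (fun ω hω => ?_)
    (Set.iUnion₂_subset fun y hy => sector_subset_of_mem_children hG hy)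
  rw [mem_sector hG.connected] at hω
  have h := vertex_succ_mem_children ω (G.dist o x)
  rw [hω] at h
  refine Set.mem_biUnion h ?_
  rw [mem_sector hG.connected, dist_root_ray]

theorem dist_confluence (x : V) (ω : Boundary G o) :
    G.dist o (confluence x ω) = Nat.findGreatest
      (fun l => G.dist o (ω.vertex l) + G.dist (ω.vertex l) x = G.dist o x) (G.dist o x) := by
  rw [confluence, dist_root_ray]

theorem dist_confluence_of_mem {x : V} {ω : Boundary G o} (h : ω ∈ sector G o x) :
    G.dist o (confluence x ω) = G.dist o x := by
  refine le_antisymm ?_ h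
  rw [dist_confluence]
  exact Nat.findGreatest_le _

theorem findGreatest_congr {P Q : ℕ → Prop} [DecidablePred P] [DecidablePred Q] {n : ℕ}
    (h : ∀ l, l ≤ n → (P l ↔ Q l)) : Nat.findGreatest P n = Nat.findGreatest Q n := by
  induction n with
  | zero => rfl
  | succ n ih =>
    rw [Nat.findGreatest_succ, Nat.findGreatest_succ, ih fun l hl => h l (by omega)]
    exact if_congr (h _ le_rfl) rfl rfl

/-- The geodesic from o to y is the one to x followed by the edge xy. A ray that misses y therefore
leaves both geodesics at the same vertex. -/
theorem dist_confluence_of_notMem [G.LocallyFinite] (hG : G.IsTree) {x y : V}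
    (hy : y ∈ children G o x) {ω : Boundary G o} (h : ω ∉ sector G o y) :
    G.dist o (confluence y ω) = G.dist o (confluence x ω) := by
  have hc := hG.connected
  have hy' := mem_children.1 hy
  rw [dist_confluence, dist_confluence, hy'.2, Nat.findGreatest_of_not]
  swap
  · rw [dist_root_ray]
    intro h1
    refine h ((mem_sector hc).2 ?_)
    rw [hy'.2]
    exact hc.dist_eq_zero_iff.1 (by omega)
  have hiff : ∀ l, l ≤ G.dist o x →
      (G.dist o (ω.vertex l) + G.dist (ω.vertex l) y = G.dist o x + 1 ↔
        G.dist o (ω.vertex l) + G.dist (ω.vertex l) x = G.dist o x) := by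
    intro l hl
    rw [dist_root_ray]
    have h1 : G.dist x y = 1 := SimpleGraph.dist_eq_one_iff_adj.2 hy'.1
    have h2 := hc.dist_triangle (u := ω.vertex l) (v := x) (w := y)
    have h3 := hc.dist_triangle (u := o) (v := ω.vertex l) (w := y)
    rw [dist_root_ray] at h3
    constructor
    -- If ω_l ≠ y lies on the geodesic to y, the neighbour w of y next on the way back to ω_l is
    -- also one step closer to o. Uniqueness of the parent gives w = x, so ω_l lies on the geodesic
    -- to x.
    · intro h4
      have h5 : y ≠ ω.vertex l := by
        intro h5
        rw [← h5, SimpleGraph.dist_self] at h4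
        omega
      obtain ⟨w, hw, hw'⟩ := exists_parent hc (ω.vertex l) h5
      have h6 := hc.dist_triangle (u := o) (v := ω.vertex l) (w := w)
      have h7 := hc.dist_triangle (u := o) (v := w) (w := y)
      rw [dist_root_ray] at h6
      rw [SimpleGraph.dist_eq_one_iff_adj.2 hw] at h7
      have h8 : w = x := parent_unique hG o hw (by omega) hy'.1 hy'.2.symm
      rw [h8] at hw'
      omega
    · intro h4
      omega
  exact findGreatest_congr hiff

theorem poissonKernel_of_mem_sector {q : ℕ} {x : V} {ω : Boundary G o} (h : ω ∈ sector G o x) :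
    poissonKernel q x ω = (q : ℝ) ^ G.dist o x := by
  rw [poissonKernel, dist_confluence_of_mem h, two_mul, add_sub_cancel_right, zpow_natCast]

theorem poissonKernel_child_of_notMem [G.LocallyFinite] (hG : G.IsTree) {q : ℕ} (hq : q ≠ 0)
    {x y : V} (hy : y ∈ children G o x) {ω : Boundary G o} (h : ω ∉ sector G o y) :
    poissonKernel q y ω = poissonKernel q x ω / q := by
  have hq' : (q : ℝ) ≠ 0 := Nat.cast_ne_zero.2 hq
  rw [poissonKernel, poissonKernel, dist_confluence_of_notMem hG hy h, dist_of_mem_children hy,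
    div_eq_mul_inv, ← zpow_sub_one₀ hq']
  congr 1
  push_cast
  ring

theorem poissonKernel_pos {q : ℕ} (hq : q ≠ 0) (x : V) (ω : Boundary G o) :
    0 < poissonKernel q x ω :=
  zpow_pos (Nat.cast_pos.2 (Nat.pos_of_ne_zero hq)) _

end Rays

/-! ### The filtration of the boundary by levels -/

section Levels

variable {V : Type*} {G : SimpleGraph V} {o : V}

theorem measurableSet_sector (x : V) : MeasurableSet (sector G o x) :=
  MeasurableSpace.measurableSet_generateFrom ⟨x, rfl⟩

theorem vertex_preimage_eq_biUnion [G.LocallyFinite] (hG : G.Connected) (n : ℕ) (A : Set V) :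
    (fun ω : Boundary G o => ω.vertex n) ⁻¹' A =
      ⋃ x ∈ ((finite_sphere hG o n).subset (Set.inter_subset_left (t := A))).toFinset,
        sector G o x := by
  ext ω
  simp only [Set.mem_preimage, Set.mem_iUnion, Set.Finite.mem_toFinset, Set.mem_inter_iff,
    Set.mem_ofPred_eq, mem_sector hG, exists_prop]
  constructor
  · exact fun h => ⟨ω.vertex n, ⟨dist_root_ray ω n, h⟩, by rw [dist_root_ray]⟩
  · rintro ⟨x, ⟨rfl, hx⟩, hx'⟩
    rwa [hx']

/-- The filtration of the boundary by the first vertices of a ray. -/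
noncomputable def levelFiltration [G.LocallyFinite] (hG : G.IsTree) (o : V) :
    Filtration ℕ (boundaryMeasurableSpace G o) where
  seq n := MeasurableSpace.comap (fun ω => ω.vertex n) ⊤
  -- The vertex at level n is the parent of the vertex at level n + 1, so the latter alone
  -- determines all earlier ones.
  mono' := by
    refine monotone_nat_of_le_succ fun n => ?_
    rintro _ ⟨A, -, rfl⟩
    refine ⟨parent hG.connected o ⁻¹' A, trivial, ?_⟩
    ext ω
    simp [parent_vertex_succ hG]
  le' n := by
    rintro _ ⟨A, -, rfl⟩
    rw [vertex_preimage_eq_biUnion hG.connected]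
    exact Finset.measurableSet_biUnion _ fun x _ => measurableSet_sector x

theorem measurableSet_levelFiltration_iff [G.LocallyFinite] (hG : G.IsTree) {n : ℕ}
    {s : Set (Boundary G o)} :
    MeasurableSet[levelFiltration hG o n] s ↔ ∃ A, (fun ω => ω.vertex n) ⁻¹' A = s :=
  ⟨fun ⟨A, _, h⟩ => ⟨A, h⟩, fun ⟨A, h⟩ => ⟨A, trivial, h⟩⟩

/-- The sector E(x) is the event that the ray is at x at time |x|. This identifies the limit of the
sector averages of F as F itself. -/
theorem iSup_levelFiltration [G.LocallyFinite] (hG : G.IsTree) :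
    ⨆ n, levelFiltration hG o n = boundaryMeasurableSpace G o := by
  refine le_antisymm (iSup_le fun n => (levelFiltration hG o).le n) ?_
  refine MeasurableSpace.generateFrom_le ?_
  rintro _ ⟨x, rfl⟩
  refine (le_iSup (levelFiltration hG o) (G.dist o x)) _
    ((measurableSet_levelFiltration_iff hG).2 ⟨{x}, ?_⟩)
  ext ω
  simp [mem_sector hG.connected]

theorem stronglyMeasurable_level [G.LocallyFinite] (hG : G.IsTree) {E : Type*}
    [NormedAddCommGroup E] [SecondCountableTopology E] (n : ℕ) (φ : V → E) :
    StronglyMeasurable[levelFiltration hG o n] fun ω => φ (ω.vertex n) := by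
  borelize E
  refine Measurable.stronglyMeasurable (mα := levelFiltration hG o n) ?_
  exact fun A _ => (measurableSet_levelFiltration_iff hG).2 ⟨φ ⁻¹' A, rfl⟩

end Levels

/-! ### Averages over children and over sectors as conditional expectations -/

section Averages

variable {V : Type*} {G : SimpleGraph V} [G.LocallyFinite] {q : ℕ} {o : V} {E : Type*}
  [NormedAddCommGroup E] [NormedSpace ℝ E]

theorem sectorMass_ne_zero {q : ℕ} (n : ℕ) : sectorMass q n ≠ 0 := by
  rw [sectorMass]
  split_ifs
  · exact one_ne_zero
  · refine (ENNReal.div_pos one_ne_zero ?_).ne'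
    exact ENNReal.mul_ne_top (by simp) (ENNReal.pow_ne_top (by simp))

theorem sectorMass_ne_top {q : ℕ} (hq : q ≠ 0) (n : ℕ) : sectorMass q n ≠ ∞ := by
  rw [sectorMass]
  split_ifs
  · exact ENNReal.one_ne_top
  · refine ENNReal.div_ne_top ENNReal.one_ne_top (mul_ne_zero (by simp) (pow_ne_zero _ ?_))
    simpa using hq

theorem IsHomogeneousTree.ne_zero (hG : IsHomogeneousTree G q) : q ≠ 0 := by
  have := hG.two_le
  omega

instance isProbabilityMeasure_boundaryMeasure (hG : IsHomogeneousTree G q) :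
    IsProbabilityMeasure (boundaryMeasure hG o) :=
  ⟨by rw [← sector_root hG.isTree.connected, boundaryMeasure_sector, SimpleGraph.dist_self]
      simp [sectorMass]⟩

theorem card_children_pos (hG : IsHomogeneousTree G q) (x : V) :
    0 < (children G o x).card := by
  have := hG.two_le
  by_cases hx : x = o
  · rw [hx, card_children_root hG]; omega
  · rw [card_children_of_ne hG hx]; omega

theorem real_sector_pos (hG : IsHomogeneousTree G q) (x : V) :
    0 < (boundaryMeasure hG o).real (sector G o x) := by
  rw [measureReal_def, boundaryMeasure_sector]
  exact ENNReal.toReal_pos (sectorMass_ne_zero _) (sectorMass_ne_top hG.ne_zero _)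

theorem real_sector_congr (hG : IsHomogeneousTree G q) {x y : V} (h : G.dist o x = G.dist o y) :
    (boundaryMeasure hG o).real (sector G o x) = (boundaryMeasure hG o).real (sector G o y) := by
  rw [measureReal_def, measureReal_def, boundaryMeasure_sector, boundaryMeasure_sector, h]

theorem setIntegral_sector_eq_sum (hG : IsHomogeneousTree G q) {F : Boundary G o → E}
    (hF : Integrable F (boundaryMeasure hG o)) (x : V) :
    ∫ ω in sector G o x, F ω ∂boundaryMeasure hG o =
      ∑ y ∈ children G o x, ∫ ω in sector G o y, F ω ∂boundaryMeasure hG o := by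
  rw [sector_eq_biUnion hG.isTree x]
  refine integral_biUnion_finset _ (fun y _ => measurableSet_sector y)
    (fun y hy z hz hyz => ?_) fun y _ => hF.integrableOn
  exact sector_disjoint hG.isTree.connected
    ((dist_of_mem_children hy).trans (dist_of_mem_children hz).symm) hyz

theorem real_sector_child (hG : IsHomogeneousTree G q) {x y : V} (hy : y ∈ children G o x) :
    (children G o x).card * (boundaryMeasure hG o).real (sector G o y) =
      (boundaryMeasure hG o).real (sector G o x) := by
  have h := setIntegral_sector_eq_sum (o := o) hG (integrable_const (1 : ℝ)) x
  simp only [setIntegral_const, smul_eq_mul, mul_one] at h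
  rw [h, Finset.sum_congr rfl fun z hz => real_sector_congr hG
    ((dist_of_mem_children hz).trans (dist_of_mem_children hy).symm), Finset.sum_const,
    nsmul_eq_mul]

/-- The average of a function on the vertices over the children of a vertex. -/
noncomputable def childAverage (G : SimpleGraph V) [G.LocallyFinite] (o : V) (u : V → E) (x : V) :
    E :=
  ((children G o x).card : ℝ)⁻¹ • ∑ y ∈ children G o x, u y

/-- The average of a function on the boundary over a sector. -/
noncomputable def sectorAverage (hG : IsHomogeneousTree G q) (F : Boundary G o → E) (x : V) : E :=
  ⨍ ω in sector G o x, F ω ∂boundaryMeasure hG o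

theorem card_smul_childAverage (hG : IsHomogeneousTree G q) (u : V → E) (x : V) :
    ((children G o x).card : ℝ) • childAverage G o u x = ∑ y ∈ children G o x, u y := by
  have := card_children_pos (o := o) hG x
  rw [childAverage, smul_inv_smul₀ (by positivity)]

theorem real_smul_sectorAverage (hG : IsHomogeneousTree G q) (F : Boundary G o → E) (x : V) :
    (boundaryMeasure hG o).real (sector G o x) • sectorAverage hG F x =
      ∫ ω in sector G o x, F ω ∂boundaryMeasure hG o :=
  measure_smul_setAverage _ (measure_ne_top _ _)

theorem childAverage_sectorAverage (hG : IsHomogeneousTree G q) {F : Boundary G o → E}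
    (hF : Integrable F (boundaryMeasure hG o)) (x : V) :
    childAverage G o (sectorAverage hG F) x = sectorAverage hG F x := by
  have h1 := setIntegral_sector_eq_sum hG hF x
  have h2 := real_sector_pos (o := o) hG x
  have h3 := card_children_pos (o := o) hG x
  refine smul_right_injective E h2.ne' ?_
  simp only
  rw [real_smul_sectorAverage, h1, childAverage, smul_smul, Finset.smul_sum]
  refine Finset.sum_congr rfl fun y hy => ?_
  rw [← real_smul_sectorAverage, ← real_sector_child hG hy]
  congr 1
  field_simp

/-- Spheres are finite, so a function of the n-th vertex takes finitely many values and is bounded.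
-/
theorem integrable_level {E : Type*} [NormedAddCommGroup E] [SecondCountableTopology E]
    (hG : IsHomogeneousTree G q) (n : ℕ) (φ : V → E) :
    Integrable (fun ω => φ (ω.vertex n)) (boundaryMeasure hG o) := by
  refine Integrable.of_bound (C := ∑ x ∈ (finite_sphere hG.isTree.connected o n).toFinset, ‖φ x‖)
    ((stronglyMeasurable_level hG.isTree n φ).mono ((levelFiltration hG.isTree o).le
      n)).aestronglyMeasurable (ae_of_all _ fun ω => ?_)
  exact Finset.single_le_sum (f := fun x => ‖φ x‖) (fun x _ => norm_nonneg _)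
    ((Set.Finite.mem_toFinset _).2 (dist_root_ray ω n))

theorem setIntegral_level_of_dist_eq [CompleteSpace E] (hG : IsHomogeneousTree G q) (φ : V → E)
    {x : V} {n : ℕ} (hx : G.dist o x = n) :
    ∫ ω in sector G o x, φ (ω.vertex n) ∂boundaryMeasure hG o =
      (boundaryMeasure hG o).real (sector G o x) • φ x := by
  rw [setIntegral_congr_fun (measurableSet_sector x) (g := fun _ => φ x), setIntegral_const]
  intro ω hω
  rw [mem_sector hG.isTree.connected, hx] at hω
  simp only [hω]

theorem sectorAverage_level_of_dist_eq [CompleteSpace E] (hG : IsHomogeneousTree G q) (φ : V → E)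
    {x : V} {n : ℕ} (hx : G.dist o x = n) :
    sectorAverage hG (fun ω : Boundary G o => φ (ω.vertex n)) x = φ x := by
  refine smul_right_injective E (real_sector_pos (o := o) hG x).ne' ?_
  simp only
  rw [real_smul_sectorAverage, setIntegral_level_of_dist_eq hG φ hx]

theorem sectorAverage_level_succ [CompleteSpace E] [SecondCountableTopology E]
    (hG : IsHomogeneousTree G q) (φ : V → E) {x : V} {n : ℕ} (hx : G.dist o x = n) :
    sectorAverage hG (fun ω : Boundary G o => φ (ω.vertex (n + 1))) x =
      childAverage G o φ x := by
  rw [← childAverage_sectorAverage hG (integrable_level hG (n + 1) φ), childAverage, childAverage]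
  congr 1
  refine Finset.sum_congr rfl fun y hy => sectorAverage_level_of_dist_eq hG φ ?_
  rw [dist_of_mem_children hy, hx]

/-- Every event of level n is a finite disjoint union of sectors E(x) with |x| = n, so it suffices
to compare integrals over one such sector. -/
theorem sectorAverage_ae_eq_condExp [CompleteSpace E] [SecondCountableTopology E]
    (hG : IsHomogeneousTree G q) {F : Boundary G o → E} (hF : Integrable F (boundaryMeasure hG o))
    (n : ℕ) : (fun ω => sectorAverage hG F (ω.vertex n)) =ᵐ[boundaryMeasure hG o]
      (boundaryMeasure hG o)[F | levelFiltration hG.isTree o n] := by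
  refine ae_eq_condExp_of_forall_setIntegral_eq ((levelFiltration hG.isTree o).le n) hF
    (fun s _ _ => (integrable_level hG n _).integrableOn) (fun s hs _ => ?_)
    (stronglyMeasurable_level hG.isTree n _).aestronglyMeasurable
  obtain ⟨A, rfl⟩ := (measurableSet_levelFiltration_iff hG.isTree).1 hs
  have hdisj : ∀ T : Finset V, (∀ x ∈ T, G.dist o x = n) →
      (T : Set V).Pairwise (Function.onFun Disjoint (sector G o)) := fun T hT x hx y hy hxy =>
    sector_disjoint hG.isTree.connected ((hT x hx).trans (hT y hy).symm) hxy
  have hT : ∀ x ∈ ((finite_sphere hG.isTree.connected o n).subset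
      (Set.inter_subset_left (t := A))).toFinset, G.dist o x = n := fun x hx =>
    ((Set.Finite.mem_toFinset _).1 hx).1
  rw [vertex_preimage_eq_biUnion hG.isTree.connected,
    integral_biUnion_finset _ (fun x _ => measurableSet_sector x) (hdisj _ hT)
      fun x _ => (integrable_level hG n _).integrableOn,
    integral_biUnion_finset _ (fun x _ => measurableSet_sector x) (hdisj _ hT)
      fun x _ => hF.integrableOn]
  refine Finset.sum_congr rfl fun x hx => ?_
  rw [setIntegral_level_of_dist_eq hG _ (hT x hx), real_smul_sectorAverage]

/-- The children of a vertex carry equal mass. Hence the functions fixed by `childAverage` are the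
martingales, and the averaging contracts L^r norms. -/
theorem childAverage_ae_eq_condExp [CompleteSpace E] [SecondCountableTopology E]
    (hG : IsHomogeneousTree G q) (u : V → E) (n : ℕ) :
    (fun ω => childAverage G o u (ω.vertex n)) =ᵐ[boundaryMeasure hG o]
      (boundaryMeasure hG o)[fun ω => u (ω.vertex (n + 1)) | levelFiltration hG.isTree o n] := by
  refine Filter.EventuallyEq.trans (ae_of_all _ fun ω => ?_)
    (sectorAverage_ae_eq_condExp hG (integrable_level hG (n + 1) u) n)
  exact (sectorAverage_level_succ hG u (dist_root_ray ω n)).symm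

theorem integral_level_succ [CompleteSpace E] [SecondCountableTopology E]
    (hG : IsHomogeneousTree G q) (u : V → E) (n : ℕ) :
    ∫ ω : Boundary G o, u (ω.vertex (n + 1)) ∂boundaryMeasure hG o =
      ∫ ω : Boundary G o, childAverage G o u (ω.vertex n) ∂boundaryMeasure hG o := by
  rw [integral_congr_ae (childAverage_ae_eq_condExp hG u n), integral_condExp]

end Averages

/-! ### L^r norms on spheres and the Hardy norm -/

section LevelNorm

variable {V : Type*} {G : SimpleGraph V} [G.LocallyFinite] {q : ℕ} {o : V} {E : Type*}
  [NormedAddCommGroup E]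

/-- The `L ^ r` norm of the restriction of `u` to the sphere of radius `n` around `o`. -/
noncomputable def levelNorm (hG : IsHomogeneousTree G q) (o : V) (r : ℝ) (n : ℕ) (u : V → E) :
    ℝ≥0∞ :=
  eLpNorm (fun ω : Boundary G o => u (ω.vertex n)) (ENNReal.ofReal r) (boundaryMeasure hG o)

theorem lintegral_comp_of_finite_range {α β : Type*} [MeasurableSpace α] (μ : Measure α)
    {X : α → β} {S : Finset β} (hS : ∀ a, X a ∈ S) (hX : ∀ x ∈ S, MeasurableSet (X ⁻¹' {x}))
    (φ : β → ℝ≥0∞) : ∫⁻ a, φ (X a) ∂μ = ∑ x ∈ S, φ x * μ (X ⁻¹' {x}) := by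
  classical
  have h : ∀ a, φ (X a) = ∑ x ∈ S, (X ⁻¹' {x}).indicator (fun _ => φ x) a := by
    intro a
    rw [Finset.sum_eq_single_of_mem (X a) (hS a)]
    · simp
    · intro b _ hb
      exact Set.indicator_of_notMem (fun h : X a = b => hb h.symm) _
  rw [lintegral_congr h, lintegral_finsetSum' _
    fun x hx => (measurable_const.indicator (hX x hx)).aemeasurable]
  exact Finset.sum_congr rfl fun x hx => lintegral_indicator_const (hX x hx) _

/-- Both k · ω_n, for k distributed by Haar measure, and the n-th vertex of a ν-random ray are
uniformly distributed on the sphere of radius n. This turns the Hardy norm into norms of functions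
on Ω. -/
theorem lintegral_haarK (hG : IsHomogeneousTree G q) (ω₀ : Boundary G o) (n : ℕ) (φ : V → ℝ≥0∞) :
    ∫⁻ k : rootStabilizer G o, φ ((k : Equiv.Perm V) (ω₀.vertex n)) ∂haarK hG o =
      ∫⁻ ω : Boundary G o, φ (ω.vertex n) ∂boundaryMeasure hG o := by
  have hc := hG.isTree.connected
  rw [lintegral_comp_of_finite_range (haarK hG o)
      (X := fun k : rootStabilizer G o => (k : Equiv.Perm V) (ω₀.vertex n))
      (S := (finite_sphere hc o n).toFinset)
      (fun k => (Set.Finite.mem_toFinset _).2 ((dist_root_apply k _).trans (dist_root_ray ω₀ n)))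
      fun x _ => (isOpen_setOf_apply_eq _ x).measurableSet,
    lintegral_comp_of_finite_range (boundaryMeasure hG o)
      (X := fun ω : Boundary G o => ω.vertex n) (S := (finite_sphere hc o n).toFinset)
      (fun ω => (Set.Finite.mem_toFinset _).2 (dist_root_ray ω n))
      fun x _ => (levelFiltration hG.isTree o).le n _
        ((measurableSet_levelFiltration_iff hG.isTree).2 ⟨_, rfl⟩)]
  refine Finset.sum_congr rfl fun x hx => ?_
  have hx' : x ∈ {x | G.dist o x = n} := (Set.Finite.mem_toFinset _).1 hx
  change G.dist o x = n at hx'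
  have h1 : (fun ω : Boundary G o => ω.vertex n) ⁻¹' {x} = sector G o x := by
    ext ω
    simp [mem_sector hc, hx']
  rw [h1, boundaryMeasure_sector, hx', ← dist_root_ray ω₀ n,
    ← haarK_setOf_apply_eq hG (y := x) (by rw [hx', dist_root_ray]), dist_root_ray]
  rfl

theorem hardyNorm_eq_iSup_levelNorm (hG : IsHomogeneousTree G q) (ω₀ : Boundary G o) {r : ℝ}
    (hr : 0 < r) (u : V → ℂ) :
    hardyNorm hG ω₀ r u = ⨆ n : ℕ, (q : ℝ≥0∞) ^ ((n : ℝ) / 2) * levelNorm hG o r n u := by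
  refine iSup_congr fun n => ?_
  rw [levelNorm, eLpNorm_eq_lintegral_rpow_enorm_toReal (by simpa using hr) ENNReal.ofReal_ne_top,
    ENNReal.toReal_ofReal hr.le, lintegral_haarK hG ω₀ n fun x => ‖u x‖ₑ ^ r]

theorem levelNorm_childAverage_le [NormedSpace ℝ E] [CompleteSpace E] [SecondCountableTopology E]
    (hG : IsHomogeneousTree G q) {r : ℝ} (hr : 1 ≤ r) (n : ℕ) (u : V → E) :
    levelNorm hG o r n (childAverage G o u) ≤ levelNorm hG o r (n + 1) u := by
  rw [levelNorm, eLpNorm_congr_ae (childAverage_ae_eq_condExp hG u n)]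
  exact eLpNorm_condExp_le_eLpNorm _ (by simpa using hr)

theorem levelNorm_iterate_childAverage_le [NormedSpace ℝ E] [CompleteSpace E]
    [SecondCountableTopology E] (hG : IsHomogeneousTree G q) {r : ℝ} (hr : 1 ≤ r) (k n : ℕ)
    (u : V → E) :
    levelNorm hG o r n ((childAverage G o)^[k] u) ≤ levelNorm hG o r (n + k) u := by
  induction k generalizing n with
  | zero => simp
  | succ k ih =>
    rw [Function.iterate_succ_apply']
    refine (levelNorm_childAverage_le hG hr n _).trans ((ih (n + 1)).trans (le_of_eq ?_))
    congr 1
    ring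

theorem levelNorm_sectorAverage_le [NormedSpace ℝ E] [CompleteSpace E]
    [SecondCountableTopology E] (hG : IsHomogeneousTree G q) {r : ℝ} (hr : 1 ≤ r) (n : ℕ)
    {F : Boundary G o → E} (hF : Integrable F (boundaryMeasure hG o)) :
    levelNorm hG o r n (sectorAverage hG F) ≤
      eLpNorm F (ENNReal.ofReal r) (boundaryMeasure hG o) := by
  rw [levelNorm, eLpNorm_congr_ae (sectorAverage_ae_eq_condExp hG hF n)]
  exact eLpNorm_condExp_le_eLpNorm _ (by simpa using hr)

theorem levelNorm_comp_parent (hG : IsHomogeneousTree G q) (r : ℝ) (n : ℕ) (u : V → E) :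
    levelNorm hG o r (n + 1) (fun x => u (parent hG.isTree.connected o x)) =
      levelNorm hG o r n u := by
  simp only [levelNorm, parent_vertex_succ hG.isTree]

theorem levelNorm_congr (hG : IsHomogeneousTree G q) (r : ℝ) {n : ℕ} {u v : V → E}
    (h : ∀ x, G.dist o x = n → u x = v x) : levelNorm hG o r n u = levelNorm hG o r n v := by
  rw [levelNorm, levelNorm]
  congr 1
  ext ω
  exact h _ (dist_root_ray ω n)

theorem levelNorm_add_le [SecondCountableTopology E] (hG : IsHomogeneousTree G q) {r : ℝ}
    (hr : 1 ≤ r) (n : ℕ) (u v : V → E) :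
    levelNorm hG o r n (fun x => u x + v x) ≤ levelNorm hG o r n u + levelNorm hG o r n v :=
  eLpNorm_add_le (integrable_level hG n u).aestronglyMeasurable
    (integrable_level hG n v).aestronglyMeasurable (by simpa using hr)

theorem levelNorm_mul (hG : IsHomogeneousTree G q) (r : ℝ) (n : ℕ) (c : ℂ) (u : V → ℂ) :
    levelNorm hG o r n (fun x => c * u x) = ‖c‖ₑ * levelNorm hG o r n u :=
  eLpNorm_const_smul c _ _ _

theorem levelNorm_const (hG : IsHomogeneousTree G q) {r : ℝ} (hr : 0 < r) (n : ℕ) (c : E) :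
    levelNorm hG o r n (fun _ => c) = ‖c‖ₑ := by
  rw [levelNorm, eLpNorm_const' c (by simpa using hr) ENNReal.ofReal_ne_top]
  simp

theorem levelNorm_le_of_norm_le {E' : Type*} [NormedAddCommGroup E'] (hG : IsHomogeneousTree G q)
    (r : ℝ) (n : ℕ) {u : V → E} {v : V → E'} (h : ∀ x, ‖u x‖ ≤ ‖v x‖) :
    levelNorm hG o r n u ≤ levelNorm hG o r n v :=
  eLpNorm_mono fun _ => h _

theorem memLp_level [SecondCountableTopology E] (hG : IsHomogeneousTree G q) (p : ℝ≥0∞) (n : ℕ)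
    (u : V → E) : MemLp (fun ω => u (ω.vertex n)) p (boundaryMeasure hG o) := by
  refine MemLp.of_bound (integrable_level hG n u).aestronglyMeasurable
    (∑ x ∈ (finite_sphere hG.isTree.connected o n).toFinset, ‖u x‖) (ae_of_all _ fun ω => ?_)
  exact Finset.single_le_sum (f := fun x => ‖u x‖) (fun x _ => norm_nonneg _)
    ((Set.Finite.mem_toFinset _).2 (dist_root_ray ω n))

theorem levelNorm_ne_top [SecondCountableTopology E] (hG : IsHomogeneousTree G q) (r : ℝ) (n : ℕ)
    (u : V → E) : levelNorm hG o r n u ≠ ∞ :=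
  (memLp_level hG _ n u).eLpNorm_ne_top

theorem levelNorm_eq_integral [SecondCountableTopology E] (hG : IsHomogeneousTree G q) {r : ℝ}
    (hr : 0 < r) (n : ℕ) (u : V → E) :
    levelNorm hG o r n u =
      ENNReal.ofReal ((∫ ω : Boundary G o, ‖u (ω.vertex n)‖ ^ r ∂boundaryMeasure hG o) ^ r⁻¹) := by
  rw [levelNorm, MemLp.eLpNorm_eq_integral_rpow_norm (by simpa using hr) ENNReal.ofReal_ne_top
    (memLp_level hG _ n u), ENNReal.toReal_ofReal hr.le]

end LevelNorm

/-! ### Burkholder's inequality -/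

section Transform

variable {V : Type*} {G : SimpleGraph V} [G.LocallyFinite] {q : ℕ} {o : V}

/-- The multiplier is the same for all children of x, so the linear term of the tangent bound is a
linear function of the increments of f alone. These sum to zero, and U(f, g) is a supermartingale.
-/
theorem childAverage_bellman_le (hG : IsHomogeneousTree G q) {r C η : ℝ} {U : ℂ → ℂ → ℝ}
    (hU : IsBellman r C η U) {f g ε : V → ℂ} (hf : ∀ x, childAverage G o f x = f x)
    (hε : ∀ x, ‖ε x‖ ≤ 1) (hg : ∀ x, ∀ y ∈ children G o x, g y - g x = ε x * (f y - f x)) (x : V) :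
    childAverage G o (fun y => U (f y) (g y)) x ≤ U (f x) (g x) := by
  obtain ⟨L, hL⟩ := hU.2.2 (f x) (g x)
  have hN : 0 < ((children G o x).card : ℝ) := by exact_mod_cast card_children_pos hG x
  have h1 : ∀ y ∈ children G o x, U (f y) (g y) ≤
      U (f x) (g x) + L (f y - f x, ε x * (f y - f x)) := by
    intro y hy
    have := hL (f y - f x) (ε x * (f y - f x)) (by
      rw [norm_mul]
      exact mul_le_of_le_one_left (norm_nonneg _) (hε x))
    rw [← hg x y hy] at this ⊢
    simpa using this
  have h2 : ∑ y ∈ children G o x, (f y - f x) = 0 := by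
    rw [Finset.sum_sub_distrib, ← card_smul_childAverage hG, hf, Finset.sum_const,
      ← Nat.cast_smul_eq_nsmul ℝ, sub_self]
  have h3 : ∑ y ∈ children G o x, L (f y - f x, ε x * (f y - f x)) = 0 := by
    have := map_sum (L ∘ₗ LinearMap.prod LinearMap.id (LinearMap.mulLeft ℝ (ε x)))
      (fun y => f y - f x) (children G o x)
    rw [h2, map_zero] at this
    exact this.symm
  have h4 := Finset.sum_le_sum h1
  rw [Finset.sum_add_distrib, h3, add_zero, Finset.sum_const, nsmul_eq_mul] at h4
  rw [childAverage, smul_eq_mul, inv_mul_le_iff₀ hN]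
  exact h4

theorem integral_bellman_le (hG : IsHomogeneousTree G q) {r C η : ℝ} {U : ℂ → ℂ → ℝ}
    (hU : IsBellman r C η U) {f g ε : V → ℂ} (hf : ∀ x, childAverage G o f x = f x)
    (hε : ∀ x, ‖ε x‖ ≤ 1) (hg : ∀ x, ∀ y ∈ children G o x, g y - g x = ε x * (f y - f x))
    (hgo : g o = 0) (n : ℕ) :
    ∫ ω : Boundary G o, U (f (ω.vertex n)) (g (ω.vertex n)) ∂boundaryMeasure hG o ≤ η := by
  induction n with
  | zero =>
    simp only [Boundary.vertex_zero, hgo, integral_const, probReal_univ, one_smul]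
    exact hU.2.1 _
  | succ n ih =>
    rw [integral_level_succ hG (fun y => U (f y) (g y))]
    refine le_trans (integral_mono (integrable_level hG n _)
      (integrable_level hG n fun y => U (f y) (g y)) fun ω => ?_) ih
    exact childAverage_bellman_le hG hU hf hε hg _

/-- Burkholder's inequality for martingale transforms on a homogeneous tree. -/
theorem exists_levelNorm_transform_le (hG : IsHomogeneousTree G q) (o : V) {r : ℝ} (hr : 1 < r) :
    ∃ C : ℝ, 0 ≤ C ∧ ∀ f g ε : V → ℂ, (∀ x, childAverage G o f x = f x) → (∀ x, ‖ε x‖ ≤ 1) →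
      (∀ x, ∀ y ∈ children G o x, g y - g x = ε x * (f y - f x)) → g o = 0 →
      ∀ n, levelNorm hG o r n g ≤ ENNReal.ofReal C * levelNorm hG o r n f := by
  obtain ⟨C, hC, hCU⟩ := exists_isBellman hr
  refine ⟨C ^ r⁻¹, by positivity, fun f g ε hf hε hg hgo n => ?_⟩
  have hr0 : 0 < r := by linarith
  have h : ∫ ω : Boundary G o, ‖g (ω.vertex n)‖ ^ r ∂boundaryMeasure hG o ≤
      C * ∫ ω : Boundary G o, ‖f (ω.vertex n)‖ ^ r ∂boundaryMeasure hG o := by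
    -- The error η/2 enters twice: in the majorization by U, and in the bound for the integral of U
    -- inherited from the root. The constant C does not depend on η.
    refine le_of_forall_pos_le_add fun η hη => ?_
    obtain ⟨U, hU⟩ := hCU (η / 2) (by positivity)
    have h1 := integral_bellman_le hG hU hf hε hg hgo n
    have i1 := integrable_level (o := o) hG n fun x => C * ‖f x‖ ^ r
    have i2 := integrable_level (o := o) hG n fun x => U (f x) (g x)
    have i3 := integrable_level (o := o) hG n fun x => ‖g x‖ ^ r
    have h2 := integral_mono i3 ((i1.add i2).add (integrable_const (η / 2)))
      fun ω => hU.1 (f (ω.vertex n)) (g (ω.vertex n))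
    rw [integral_add' (i1.add i2) (integrable_const _), integral_add' i1 i2, integral_const_mul,
      integral_const, probReal_univ, one_smul] at h2
    linarith
  rw [levelNorm_eq_integral hG hr0, levelNorm_eq_integral hG hr0,
    ← ENNReal.ofReal_mul (by positivity),
    ← Real.mul_rpow hC (integral_nonneg fun ω => by positivity)]
  refine ENNReal.ofReal_le_ofReal (Real.rpow_le_rpow (integral_nonneg fun ω => ?_) h
    (by positivity))
  positivity

end Transform

/-! ### Martingale convergence: boundary functions from bounded martingales -/

section Convergence

variable {V : Type*} {G : SimpleGraph V} [G.LocallyFinite] {q : ℕ} {o : V}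

theorem tendsto_sectorAverage_real (hG : IsHomogeneousTree G q) {F : Boundary G o → ℝ}
    (hF : Integrable F (boundaryMeasure hG o)) :
    ∀ᵐ ω ∂boundaryMeasure hG o,
      Filter.Tendsto (fun n => sectorAverage hG F (ω.vertex n)) Filter.atTop (𝓝 (F ω)) := by
  have h1 := tendsto_ae_condExp (μ := boundaryMeasure hG o) (ℱ := levelFiltration hG.isTree o) F
  rw [iSup_levelFiltration hG.isTree] at h1
  have h2 := condExp_of_aestronglyMeasurable' (μ := boundaryMeasure hG o) le_rfl hF.1 hF
  have h3 := ae_all_iff.2 fun n => sectorAverage_ae_eq_condExp hG hF n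
  filter_upwards [h1, h2, h3] with ω h1 h2 h3
  rw [h2] at h1
  exact h1.congr fun n => (h3 n).symm

theorem sectorAverage_comp_clm (hG : IsHomogeneousTree G q) {E E' : Type*} [NormedAddCommGroup E]
    [NormedSpace ℝ E] [NormedAddCommGroup E'] [NormedSpace ℝ E'] [CompleteSpace E]
    [CompleteSpace E'] (L : E →L[ℝ] E') {F : Boundary G o → E}
    (hF : Integrable F (boundaryMeasure hG o)) (x : V) :
    sectorAverage hG (fun ω => L (F ω)) x = L (sectorAverage hG F x) := by
  rw [sectorAverage, sectorAverage, setAverage_eq, setAverage_eq, map_smul,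
    ContinuousLinearMap.integral_comp_comm L hF.integrableOn]

theorem tendsto_sectorAverage (hG : IsHomogeneousTree G q) {F : Boundary G o → ℂ}
    (hF : Integrable F (boundaryMeasure hG o)) :
    ∀ᵐ ω ∂boundaryMeasure hG o,
      Filter.Tendsto (fun n => sectorAverage hG F (ω.vertex n)) Filter.atTop (𝓝 (F ω)) := by
  filter_upwards [tendsto_sectorAverage_real hG (Complex.reCLM.integrable_comp hF),
    tendsto_sectorAverage_real hG (Complex.imCLM.integrable_comp hF)] with ω h1 h2
  simp only [sectorAverage_comp_clm hG _ hF] at h1 h2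
  have h3 := ((Complex.continuous_ofReal.tendsto _).comp h1).add
    (((Complex.continuous_ofReal.tendsto _).comp h2).mul_const Complex.I)
  simpa [Function.comp_def] using h3

/-- The sector averages converge to F almost everywhere, by Lévy's upward theorem; lower
semicontinuity of the norm (Fatou) carries the bound over to F. -/
theorem eLpNorm_le_of_levelNorm_sectorAverage_le (hG : IsHomogeneousTree G q) {r : ℝ}
    {F : Boundary G o → ℂ} (hF : Integrable F (boundaryMeasure hG o)) {B : ℝ≥0∞}
    (hB : ∀ n, levelNorm hG o r n (sectorAverage hG F) ≤ B) :
    eLpNorm F (ENNReal.ofReal r) (boundaryMeasure hG o) ≤ B :=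
  Lp.eLpNorm_le_of_ae_tendsto (u := Filter.atTop) (Filter.Eventually.of_forall hB)
    (fun n => (integrable_level hG n _).aestronglyMeasurable) (tendsto_sectorAverage hG hF)

theorem abs_le_rpow_mul_rpow {C t r : ℝ} (hC : 0 < C) (ht : C ≤ t) (hr : 1 ≤ r) :
    t ≤ C ^ (1 - r) * t ^ r := by
  have ht0 := hC.trans_le ht
  have h1 : t = t ^ (1 - r) * t ^ r := by
    rw [← Real.rpow_add ht0, sub_add_cancel, Real.rpow_one]
  have h2 : t ^ (1 - r) ≤ C ^ (1 - r) := Real.rpow_le_rpow_of_nonpos hC ht (by linarith)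
  calc t = t ^ (1 - r) * t ^ r := h1
    _ ≤ _ := by gcongr

/-- Where |φ| ≥ C one has |φ| ≤ C^{1-r} |φ|^r, and C^{1-r} → 0 as C → ∞ because r > 1. -/
theorem uniformIntegrable_level (hG : IsHomogeneousTree G q) {r : ℝ} (hr : 1 < r) {φ : V → ℝ}
    {R : NNReal} (hR : ∀ n, levelNorm hG o r n φ ≤ R) :
    UniformIntegrable (fun (n : ℕ) (ω : Boundary G o) => φ (ω.vertex n)) 1
      (boundaryMeasure hG o) := by
  have hr0 : 0 < r := by linarith
  refine uniformIntegrable_of le_rfl ENNReal.one_ne_top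
    (fun n => (integrable_level hG n φ).aestronglyMeasurable) fun ε hε => ?_
  obtain ⟨C, hC, hCε⟩ : ∃ C : NNReal, 0 < C ∧ C ^ (1 - r) * R ^ r ≤ ε.toNNReal := by
    have h1 : Filter.Tendsto (fun C : ℝ => C ^ (1 - r) * (R : ℝ) ^ r) Filter.atTop (𝓝 0) := by
      have := (tendsto_rpow_neg_atTop (sub_pos.2 hr)).mul_const ((R : ℝ) ^ r)
      simpa using this
    obtain ⟨C, hC, hC'⟩ := ((Filter.eventually_gt_atTop (0 : ℝ)).and
      (h1.eventually (ge_mem_nhds hε))).exists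
    lift C to NNReal using hC.le
    refine ⟨C, NNReal.coe_pos.1 hC, ?_⟩
    rw [← NNReal.coe_le_coe, Real.coe_toNNReal ε hε.le]
    exact_mod_cast hC'
  refine ⟨C, fun n => ?_⟩
  have h2 : ∀ ω : Boundary G o, ‖{ω : Boundary G o | C ≤ ‖φ (ω.vertex n)‖₊}.indicator
      (fun ω => φ (ω.vertex n)) ω‖ₑ ≤ (C ^ (1 - r) : NNReal) * ‖φ (ω.vertex n)‖ₑ ^ r := by
    intro ω
    by_cases h : ω ∈ {ω : Boundary G o | C ≤ ‖φ (ω.vertex n)‖₊}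
    · rw [Set.indicator_of_mem h, enorm_eq_nnnorm, ← ENNReal.coe_rpow_of_nonneg _ hr0.le,
        ← ENNReal.coe_mul, ENNReal.coe_le_coe, ← NNReal.coe_le_coe]
      push_cast
      exact abs_le_rpow_mul_rpow (NNReal.coe_pos.2 hC) (by exact_mod_cast h) hr.le
    · rw [Set.indicator_of_notMem h]
      simp
  have h3 : ∫⁻ ω : Boundary G o, ‖φ (ω.vertex n)‖ₑ ^ r ∂boundaryMeasure hG o ≤ (R : ℝ≥0∞) ^ r := by
    have := hR n
    rw [levelNorm, eLpNorm_eq_lintegral_rpow_enorm_toReal (by simpa using hr0)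
      ENNReal.ofReal_ne_top, ENNReal.toReal_ofReal hr0.le, one_div,
      ENNReal.rpow_inv_le_iff hr0] at this
    exact this
  rw [eLpNorm_one_eq_lintegral_enorm]
  calc _ ≤ ∫⁻ ω : Boundary G o, (C ^ (1 - r) : NNReal) * ‖φ (ω.vertex n)‖ₑ ^ r
        ∂boundaryMeasure hG o := lintegral_mono h2
    _ = (C ^ (1 - r) : NNReal) * ∫⁻ ω : Boundary G o, ‖φ (ω.vertex n)‖ₑ ^ r
        ∂boundaryMeasure hG o := lintegral_const_mul' _ _ ENNReal.coe_ne_top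
    _ ≤ (C ^ (1 - r) : NNReal) * (R : ℝ≥0∞) ^ r := by gcongr
    _ ≤ ENNReal.ofReal ε := by
      rw [← ENNReal.coe_rpow_of_nonneg _ hr0.le, ← ENNReal.coe_mul]
      exact ENNReal.coe_le_coe.2 hCε

/-- A uniformly integrable martingale is closed by its almost sure limit, which lies in L^r by
Fatou. This is where r > 1 is indispensable for the converse in (a): for r = 1 the martingale could
come from a singular measure. -/
theorem exists_sectorAverage_eq_real (hG : IsHomogeneousTree G q) {r : ℝ} (hr : 1 < r)
    {φ : V → ℝ} (hφ : ∀ x, childAverage G o φ x = φ x) {R : NNReal}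
    (hR : ∀ n, levelNorm hG o r n φ ≤ R) :
    ∃ F : Boundary G o → ℝ, MemLp F (ENNReal.ofReal r) (boundaryMeasure hG o) ∧
      ∀ x, sectorAverage hG F x = φ x := by
  have hmart : Martingale (fun (n : ℕ) (ω : Boundary G o) => φ (ω.vertex n))
      (levelFiltration hG.isTree o) (boundaryMeasure hG o) := by
    refine martingale_nat (fun n => stronglyMeasurable_level hG.isTree n φ)
      (fun n => integrable_level hG n φ) fun n => ?_
    refine Filter.EventuallyEq.trans (ae_of_all _ fun ω => ?_) (childAverage_ae_eq_condExp hG φ n)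
    exact (hφ _).symm
  have hmem := hmart.submartingale.memLp_limitProcess hR
  refine ⟨_, hmem, fun x => ?_⟩
  have hint := hmem.integrable (by simpa using hr.le)
  have h1 := (hmart.ae_eq_condExp_limitProcess (uniformIntegrable_level hG hr hR)
    (G.dist o x)).trans (sectorAverage_ae_eq_condExp hG hint (G.dist o x)).symm
  -- The identity holds only almost everywhere on Ω. Both sides are constant on E(x), so averaging
  -- over this sector of positive mass gives it at the vertex x.
  rw [← sectorAverage_level_of_dist_eq hG φ (x := x) rfl,
    ← sectorAverage_level_of_dist_eq hG (sectorAverage hG _) (x := x) rfl]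
  exact setAverage_congr_fun (measurableSet_sector x) (h1.mono fun ω hω _ => hω.symm)

theorem exists_sectorAverage_eq (hG : IsHomogeneousTree G q) {r : ℝ} (hr : 1 < r)
    {f : V → ℂ} (hf : ∀ x, childAverage G o f x = f x) {R : NNReal}
    (hR : ∀ n, levelNorm hG o r n f ≤ R) :
    ∃ F : Boundary G o → ℂ, MemLp F (ENNReal.ofReal r) (boundaryMeasure hG o) ∧
      ∀ x, sectorAverage hG F x = f x := by
  have hL : ∀ (L : ℂ →L[ℝ] ℝ) (x : V),
      childAverage G o (fun y => L (f y)) x = L (f x) := fun L x => by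
    conv_rhs => rw [← hf x]
    rw [childAverage, childAverage, map_smul, map_sum]
  obtain ⟨F₁, hF₁, h₁⟩ := exists_sectorAverage_eq_real hG hr (hL Complex.reCLM) fun n =>
    (levelNorm_le_of_norm_le hG r n fun x => Complex.abs_re_le_norm (f x)).trans (hR n)
  obtain ⟨F₂, hF₂, h₂⟩ := exists_sectorAverage_eq_real hG hr (hL Complex.imCLM) fun n =>
    (levelNorm_le_of_norm_le hG r n fun x => Complex.abs_im_le_norm (f x)).trans (hR n)
  obtain ⟨F, hFdef⟩ : ∃ F : Boundary G o → ℂ, F = fun ω => ⟨F₁ ω, F₂ ω⟩ := ⟨_, rfl⟩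
  have e₁ : (fun ω => Complex.reCLM (F ω)) = F₁ := by rw [hFdef]; rfl
  have e₂ : (fun ω => Complex.imCLM (F ω)) = F₂ := by rw [hFdef]; rfl
  have hF : MemLp F (ENNReal.ofReal r) (boundaryMeasure hG o) := by
    refine memLp_re_im_iff.1 ⟨?_, ?_⟩
    · exact e₁.symm ▸ hF₁
    · exact e₂.symm ▸ hF₂
  refine ⟨F, hF, fun x => ?_⟩
  have hint := hF.integrable (by simpa using hr.le)
  have h3 := sectorAverage_comp_clm hG Complex.reCLM hint x
  have h4 := sectorAverage_comp_clm hG Complex.imCLM hint x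
  rw [e₁, h₁ x] at h3
  rw [e₂, h₂ x] at h4
  exact Complex.ext h3.symm h4.symm

end Convergence

/-! ### The spectral parameter and the c-function -/

section SpectralParameter

variable {q : ℕ}

theorem norm_natCast_cpow_half_add (hq : q ≠ 0) (z : ℝ) :
    ‖(q : ℂ) ^ (1 / 2 + Complex.I * z)‖ = (q : ℝ) ^ (1 / 2 : ℝ) := by
  rw [Complex.norm_natCast_cpow_of_pos (Nat.pos_of_ne_zero hq)]
  congr 1
  simp

theorem norm_natCast_cpow_I_mul (hq : q ≠ 0) (z : ℝ) : ‖(q : ℂ) ^ (Complex.I * z)‖ = 1 := by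
  rw [Complex.norm_natCast_cpow_of_pos (Nat.pos_of_ne_zero hq)]
  simp

theorem natCast_cpow_half_add (hq : q ≠ 0) (z : ℂ) :
    (q : ℂ) ^ (1 / 2 + Complex.I * z) = (q : ℂ) ^ (1 / 2 : ℂ) * (q : ℂ) ^ (Complex.I * z) :=
  Complex.cpow_add _ _ (Nat.cast_ne_zero.2 hq)

theorem natCast_cpow_half_sq (q : ℕ) : ((q : ℂ) ^ (1 / 2 : ℂ)) ^ 2 = q := by
  rw [← Complex.cpow_nat_mul]
  norm_num

theorem natCast_cpow_half_sub (hq : q ≠ 0) (z : ℂ) :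
    (q : ℂ) ^ (1 / 2 - Complex.I * z) = q / (q : ℂ) ^ (1 / 2 + Complex.I * z) := by
  have hq' : (q : ℂ) ≠ 0 := Nat.cast_ne_zero.2 hq
  have h : (1 / 2 - Complex.I * z) = 1 - (1 / 2 + Complex.I * z) := by ring
  rw [h, Complex.cpow_sub _ _ hq', Complex.cpow_one]

/-- The exclusion of (τ/2)ℤ enters the proof only through w = q^{2iz} ≠ 1. -/
theorem cpow_I_mul_sq_ne_one (hq : 2 ≤ q) {z : ℝ} (hz : ∀ k : ℤ, z ≠ (k : ℝ) * (tau q / 2)) :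
    ((q : ℂ) ^ (Complex.I * z)) ^ 2 ≠ 1 := by
  have hq' : (q : ℂ) ≠ 0 := Nat.cast_ne_zero.2 (by omega)
  have hlog : 0 < Real.log q := Real.log_pos (by exact_mod_cast hq)
  rw [← Complex.cpow_nat_mul, Complex.cpow_def_of_ne_zero hq', Ne, Complex.exp_eq_one_iff]
  rintro ⟨k, hk⟩
  apply hz k
  rw [← Complex.natCast_log] at hk
  push_cast at hk
  have h1 : Real.log q * (2 * z) = k * (2 * Real.pi) := by
    apply Complex.ofReal_injective
    apply mul_right_cancel₀ Complex.I_ne_zero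
    push_cast
    linear_combination hk
  rw [tau]
  field_simp
  linarith

theorem cFunction_eq (hq : q ≠ 0) {z w : ℂ} (hw : w = ((q : ℂ) ^ (Complex.I * z)) ^ 2) :
    cFunction q z = (q * w - 1) / (((q : ℂ) + 1) * (w - 1)) := by
  have hq' : (q : ℂ) ≠ 0 := Nat.cast_ne_zero.2 hq
  have h0 : -(1 / 2) - Complex.I * z = -(1 / 2 + Complex.I * z) := by ring
  rw [cFunction, h0, Complex.cpow_neg, Complex.cpow_neg, natCast_cpow_half_add hq, hw]
  have ha := natCast_cpow_half_sq q
  have ha0 : (q : ℂ) ^ (1 / 2 : ℂ) ≠ 0 := fun h => hq' (by rw [← ha, h]; simp)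
  have hb0 : (q : ℂ) ^ (Complex.I * z) ≠ 0 := by simp [Complex.cpow_eq_zero_iff, hq']
  set a := (q : ℂ) ^ (1 / 2 : ℂ)
  set b := (q : ℂ) ^ (Complex.I * z)
  have e1 : a * b - (a * b)⁻¹ = (q * b ^ 2 - 1) / (a * b) := by
    rw [← ha]; field_simp
  have e2 : b - b⁻¹ = (b ^ 2 - 1) / b := by field_simp
  rw [e1, e2, div_div_eq_mul_div]
  -- At the poles both sides are 0, by the convention for division by zero.
  by_cases h : b ^ 2 - 1 = 0
  · simp [h]
  have hq1 : (q : ℂ) + 1 ≠ 0 := by exact_mod_cast Nat.succ_ne_zero q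
  field_simp

/-- On the unit circle w − q is −w times the conjugate of qw − 1. As 1 − c = (w − q)/((q + 1)(w −
1)), this yields |1 − c| = |c|. -/
theorem norm_sub_natCast {w : ℂ} (hw : ‖w‖ = 1) : ‖w - q‖ = ‖(q : ℂ) * w - 1‖ := by
  have h : w * (starRingEnd ℂ) w = 1 := by
    rw [Complex.mul_conj, Complex.normSq_eq_norm_sq, hw]; norm_num
  have h1 : w - q = -(w * (starRingEnd ℂ) (q * w - 1)) := by
    rw [map_sub, map_mul, map_one, Complex.conj_natCast]
    linear_combination (q : ℂ) * h
  rw [h1, norm_neg, norm_mul, hw, one_mul, Complex.norm_conj]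

theorem natCast_mul_sub_one_ne_zero (hq : 2 ≤ q) {w : ℂ} (hw : ‖w‖ = 1) :
    (q : ℂ) * w - 1 ≠ 0 := by
  intro h
  have h1 := congrArg norm (sub_eq_zero.1 h)
  rw [norm_mul, hw, mul_one, norm_one, Complex.norm_natCast] at h1
  have : (2 : ℝ) ≤ q := by exact_mod_cast hq
  linarith

end SpectralParameter

/-! ### Two-sided estimates for the normalized Poisson transform -/

section TransformPair

variable {V : Type*} {G : SimpleGraph V} [G.LocallyFinite] {q : ℕ} {o : V}

/-- `v` is obtained from the martingale `f` by the recursion satisfied by the normalized Poisson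
transform `q ^ (|x| (1/2 + iz)) 𝒫_z F (x)` of a function `F` with sector averages `f`. -/
structure IsPoissonPair (G : SimpleGraph V) [G.LocallyFinite] (o : V) (w c : ℂ) (f v : V → ℂ) :
    Prop where
  childAverage_eq : ∀ x, childAverage G o f x = f x
  root : v o = f o
  child : ∀ x, ∀ y ∈ children G o x, v y - v x = c * (w - 1) * w ^ G.dist o x * f y

/-- Summation by parts writes v as (1 − c) f(o) + c w^{|x|} f − c g with g a martingale transform of
f. Each of the three terms is bounded by a multiple of |c|, uniformly in w and c. -/
theorem exists_levelNorm_le_of_isPoissonPair (hG : IsHomogeneousTree G q) (o : V) {r : ℝ}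
    (hr : 1 < r) : ∃ C : ℝ, 0 < C ∧ ∀ w c f v, ‖w‖ = 1 → c ≠ 0 → ‖1 - c‖ = ‖c‖ →
      IsPoissonPair G o w c f v → ∀ B, (∀ n, levelNorm hG o r n f ≤ B) →
      ∀ n, levelNorm hG o r n v ≤ ENNReal.ofReal (C * ‖c‖) * B := by
  obtain ⟨C, hC, h⟩ := exists_levelNorm_transform_le hG o hr
  refine ⟨C + 2, by linarith, fun w c f v hw hc hc' hp B hB n => ?_⟩
  -- Solving the summation by parts formula for g avoids sums along paths: g vanishes at o, and its
  -- increment from x to a child y is w^{|x|} (f(y) − f(x)).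
  set g : V → ℂ := fun x => w ^ G.dist o x * f x - (v x - (1 - c) * f o) / c with hg
  have h1 := h f g (fun x => w ^ G.dist o x) hp.childAverage_eq (fun x => by simp [hw])
    (fun x y hy => by
      have h2 := hp.child x y hy
      simp only [hg]
      rw [dist_of_mem_children hy, sub_sub_sub_comm, ← sub_div, sub_sub_sub_cancel_right, h2]
      field_simp
      ring) (by
      simp only [hg, hp.root, SimpleGraph.dist_self]
      field_simp
      ring) n
  have h2 : levelNorm hG o r n v ≤ levelNorm hG o r n (fun x => c * (w ^ G.dist o x * f x)) +
      levelNorm hG o r n (fun x => (-c) * g x) + levelNorm hG o r n (fun _ => (1 - c) * f o) := by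
    refine le_trans (le_of_eq ?_) ((levelNorm_add_le hG hr.le n _ _).trans
      (add_le_add_left (levelNorm_add_le hG hr.le n _ _) _))
    congr 1
    ext x
    simp only [hg]
    field_simp
    ring
  have h3 : levelNorm hG o r n (fun x => w ^ G.dist o x * f x) ≤ B :=
    (levelNorm_le_of_norm_le hG r n fun x => by simp [hw]).trans (hB n)
  have h4 : ‖f o‖ₑ ≤ B := by
    have := hB 0
    rwa [levelNorm_congr hG r (v := fun _ => f o) fun x hx => by
      rw [hG.isTree.connected.dist_eq_zero_iff.1 hx], levelNorm_const hG (by linarith)] at this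
  have h5 : levelNorm hG o r n g ≤ ENNReal.ofReal C * B := h1.trans (by gcongr; exact hB n)
  have h6 : ‖1 - c‖ₑ = ‖c‖ₑ := by rw [← ofReal_norm, hc', ofReal_norm]
  rw [levelNorm_mul, levelNorm_mul, enorm_neg, levelNorm_const hG (by linarith), enorm_mul,
    h6] at h2
  calc levelNorm hG o r n v ≤ ‖c‖ₑ * B + ‖c‖ₑ * (ENNReal.ofReal C * B) + ‖c‖ₑ * B :=
        h2.trans (by gcongr)
    _ = ENNReal.ofReal ((C + 2) * ‖c‖) * B := by
      rw [ENNReal.ofReal_mul (by linarith), ENNReal.ofReal_add hC zero_le_two,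
        ofReal_norm, ENNReal.ofReal_ofNat]
      ring

/-- Averaging over later levels replaces every later value of f by f(x), and the coefficients c(w −
1) w^j telescope. -/
theorem IsPoissonPair.iterate_childAverage (hG : IsHomogeneousTree G q) {w c : ℂ} {f v : V → ℂ}
    (hp : IsPoissonPair G o w c f v) (k : ℕ) (x : V) :
    (childAverage G o)^[k] v x = v x + c * (w ^ (G.dist o x + k) - w ^ G.dist o x) * f x := by
  induction k generalizing x with
  | zero => simp
  | succ k ih =>
    have hN : ((children G o x).card : ℝ) ≠ 0 := by
      exact_mod_cast (card_children_pos hG x).ne'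
    have h1 : ∀ y ∈ children G o x, (childAverage G o)^[k] v y =
        v x + c * (w ^ (G.dist o x + (k + 1)) - w ^ G.dist o x) * f y := by
      intro y hy
      rw [ih, sub_eq_iff_eq_add.1 (hp.child x y hy), dist_of_mem_children hy]
      ring
    have h2 := card_smul_childAverage (o := o) hG f x
    rw [Function.iterate_succ_apply', childAverage, Finset.sum_congr rfl h1,
      Finset.sum_add_distrib, ← Finset.mul_sum, ← h2, hp.childAverage_eq, Finset.sum_const,
      ← Nat.cast_smul_eq_nsmul ℝ, smul_add, inv_smul_smul₀ hN, mul_smul_comm, inv_smul_smul₀ hN]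

theorem le_of_forall_nat_mul_le_nat_mul_add {A H D : ℝ≥0∞} (hD : D ≠ ∞)
    (h : ∀ N : ℕ, N * A ≤ N * H + D) : A ≤ H := by
  have h1 : Filter.Tendsto (fun N : ℕ => H + D * (N : ℝ≥0∞)⁻¹) Filter.atTop (𝓝 (H + D * 0)) :=
    tendsto_const_nhds.add
      (ENNReal.Tendsto.const_mul ENNReal.tendsto_inv_nat_nhds_zero (Or.inr hD))
  rw [mul_zero, add_zero] at h1
  refine ge_of_tendsto h1 ((Filter.eventually_gt_atTop 0).mono fun N hN => ?_)
  have hN0 : (N : ℝ≥0∞) ≠ 0 := by exact_mod_cast hN.ne'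
  have hNt : (N : ℝ≥0∞) ≠ ∞ := ENNReal.natCast_ne_top N
  calc A = (N * A) * (N : ℝ≥0∞)⁻¹ := by
        rw [mul_right_comm, ENNReal.mul_inv_cancel hN0 hNt, one_mul]
    _ ≤ (N * H + D) * (N : ℝ≥0∞)⁻¹ := by gcongr; exact h N
    _ = H + D * (N : ℝ≥0∞)⁻¹ := by
      rw [add_mul, mul_right_comm, ENNReal.mul_inv_cancel hN0 hNt, one_mul]

/-- On the sphere of radius n the k-th iterated average of v, times w^{-k}, is c w^n f plus w^{-k} b
with b independent of k. Summing over k < N makes the first part grow like N while the second stays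
bounded. -/
theorem IsPoissonPair.mul_levelNorm_le (hG : IsHomogeneousTree G q) {r : ℝ} (hr : 1 < r)
    {w c : ℂ} (hw : ‖w‖ = 1) (hw1 : w ≠ 1) {f v : V → ℂ} (hp : IsPoissonPair G o w c f v)
    {H : ℝ≥0∞} (hH : ∀ n, levelNorm hG o r n v ≤ H) (n : ℕ) :
    ‖c‖ₑ * levelNorm hG o r n f ≤ H := by
  have hw0 : w ≠ 0 := norm_ne_zero_iff.1 (by rw [hw]; exact one_ne_zero)
  have hwi : ‖w⁻¹‖ = 1 := by rw [norm_inv, hw, inv_one]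
  set b : V → ℂ := fun x => v x - c * w ^ n * f x with hb
  have h1 : ∀ N : ℕ, levelNorm hG o r n (fun x => (N * (c * w ^ n)) * f x +
      (∑ k ∈ Finset.range N, w⁻¹ ^ k) * b x) ≤ N * H := by
    intro N
    induction N with
    | zero => simp [levelNorm]
    | succ N ih =>
      have h2 : levelNorm hG o r n (fun x => w⁻¹ ^ N * (childAverage G o)^[N] v x) ≤ H := by
        rw [levelNorm_mul]
        have : ‖w⁻¹ ^ N‖ₑ = 1 := by rw [← ofReal_norm, norm_pow, hwi]; simp
        rw [this, one_mul]
        exact (levelNorm_iterate_childAverage_le hG hr.le N n v).trans (hH _)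
      have h0 : ((N + 1 : ℕ) : ℝ≥0∞) * H = N * H + H := by rw [Nat.cast_succ, add_mul, one_mul]
      rw [h0]
      refine le_trans (le_of_eq ?_) ((levelNorm_add_le hG hr.le n _ _).trans (add_le_add ih h2))
      refine levelNorm_congr hG r fun x hx => ?_
      rw [hp.iterate_childAverage hG, hx, Finset.sum_range_succ]
      simp only [hb]
      push_cast
      have h3 : w⁻¹ ^ N * w ^ (n + N) = w ^ n := by
        rw [pow_add, mul_left_comm, ← mul_pow, inv_mul_cancel₀ hw0, one_pow, mul_one]
      linear_combination (-c * f x) * h3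
  -- The bound degenerates as w → 1 and the norm of b depends on n, but both are fixed while N → ∞,
  -- so they leave no trace in the estimate.
  obtain ⟨B, hB⟩ : ∃ B : ℝ, ∀ N : ℕ, ‖∑ k ∈ Finset.range N, w⁻¹ ^ k‖ ≤ B := by
    refine ⟨2 / ‖w⁻¹ - 1‖, fun N => ?_⟩
    rw [geom_sum_eq (by simpa using hw1), norm_div]
    gcongr
    refine (norm_sub_le _ _).trans ?_
    rw [norm_pow, hwi]
    norm_num
  refine le_of_forall_nat_mul_le_nat_mul_add (D := ENNReal.ofReal B * levelNorm hG o r n b)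
    (ENNReal.mul_ne_top ENNReal.ofReal_ne_top (levelNorm_ne_top hG r n b)) fun N => ?_
  have h4 : N * (‖c‖ₑ * levelNorm hG o r n f) =
      levelNorm hG o r n fun x => (N * (c * w ^ n)) * f x := by
    have : ‖w‖ₑ = 1 := by rw [← ofReal_norm, hw]; simp
    rw [levelNorm_mul, enorm_mul, enorm_mul, enorm_pow, this, one_pow, mul_one, mul_assoc]
    congr 1
    simp [← ofReal_norm]
  rw [h4]
  refine le_trans (le_of_eq ?_) ((levelNorm_add_le hG hr.le n _
    fun x => (-∑ k ∈ Finset.range N, w⁻¹ ^ k) * b x).trans (add_le_add (h1 N) ?_))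
  · congr 1
    ext x
    ring
  · rw [levelNorm_mul, enorm_neg, ← ofReal_norm]
    gcongr
    exact hB N

end TransformPair

/-! ### The recursion for the Poisson transform -/

section Poisson

theorem poissonKernel_cpow_of_mem_sector {V : Type*} {G : SimpleGraph V} {o : V} {q : ℕ} (s : ℂ)
    {x : V} {ω : Boundary G o}
    (h : ω ∈ sector G o x) :
    (poissonKernel q x ω : ℂ) ^ s = ((q : ℂ) ^ s) ^ G.dist o x := by
  rw [poissonKernel_of_mem_sector h]
  generalize G.dist o x = n
  induction n with
  | zero => simp
  | succ n ih =>
    rw [pow_succ, pow_succ, ← ih, Complex.ofReal_mul,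
      Complex.mul_cpow_ofReal_nonneg (by positivity) (by positivity), Complex.ofReal_natCast]

variable {V : Type*} {G : SimpleGraph V} [G.LocallyFinite] {q : ℕ} {o : V}

/-- Off E(y) the kernel at y is that at x divided by q, so the two normalized kernels agree there.
On E(y) the powers are explicit. Hence only the integral of F over E(y) enters the recursion. -/
theorem poissonKernel_cpow_child_sub (hG : IsHomogeneousTree G q) (s : ℂ) {x y : V}
    (hy : y ∈ children G o x) (ω : Boundary G o) :
    (q : ℂ) ^ s * (poissonKernel q y ω : ℂ) ^ s = (poissonKernel q x ω : ℂ) ^ s +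
      (sector G o y).indicator
        (fun _ => (((q : ℂ) ^ s) ^ 2 - 1) * ((q : ℂ) ^ s) ^ G.dist o x) ω := by
  by_cases h : ω ∈ sector G o y
  · rw [Set.indicator_of_mem h, poissonKernel_cpow_of_mem_sector s h,
      poissonKernel_cpow_of_mem_sector s (sector_subset_of_mem_children hG.isTree hy h),
      dist_of_mem_children hy]
    ring
  · have h0 := (poissonKernel_pos hG.ne_zero x ω).le
    have h1 : poissonKernel q x ω = q * poissonKernel q y ω := by
      rw [poissonKernel_child_of_notMem hG.isTree hG.ne_zero hy h]
      have : (q : ℝ) ≠ 0 := Nat.cast_ne_zero.2 hG.ne_zero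
      field_simp
    rw [Set.indicator_of_notMem h, add_zero, h1, Complex.ofReal_mul,
      Complex.mul_cpow_ofReal_nonneg (by positivity) (poissonKernel_pos hG.ne_zero y ω).le,
      Complex.ofReal_natCast]

theorem natCast_cpow_ne_zero (hG : IsHomogeneousTree G q) (s : ℂ) : (q : ℂ) ^ s ≠ 0 := by
  simp [Complex.cpow_eq_zero_iff, hG.ne_zero]

theorem dist_induction (hG : G.Connected) (o : V) {P : V → Prop} (root : P o)
    (child : ∀ x, ∀ y ∈ children G o x, P x → P y) (x : V) : P x := by
  have h : ∀ n x, G.dist o x = n → P x := by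
    intro n
    induction n with
    | zero => exact fun x hx => hG.dist_eq_zero_iff.1 hx ▸ root
    | succ n ih =>
      intro x hx
      have hxo : x ≠ o := by
        rintro rfl
        simp at hx
      have h1 := mem_children_parent hG hxo
      have h2 := dist_of_mem_children h1
      exact child _ x h1 (ih _ (by omega))
  exact h _ x rfl

theorem integrable_poissonKernel_cpow_mul (hG : IsHomogeneousTree G q) (s : ℂ)
    {F : Boundary G o → ℂ} (hF : Integrable F (boundaryMeasure hG o)) (x : V) :
    Integrable (fun ω => (poissonKernel q x ω : ℂ) ^ s * F ω) (boundaryMeasure hG o) := by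
  refine dist_induction hG.isTree.connected o (P := fun x =>
    Integrable (fun ω => (poissonKernel q x ω : ℂ) ^ s * F ω) (boundaryMeasure hG o)) ?_ ?_ x
  · refine hF.congr (ae_of_all _ fun ω => ?_)
    simp only
    rw [poissonKernel_cpow_of_mem_sector s
      (by rw [sector_root hG.isTree.connected]; trivial), SimpleGraph.dist_self, pow_zero, one_mul]
  · intro x y hy hx
    have h1 := (hx.add ((hF.const_mul ((((q : ℂ) ^ s) ^ 2 - 1) *
      ((q : ℂ) ^ s) ^ G.dist o x)).indicator (measurableSet_sector y))).const_mul ((q : ℂ) ^ s)⁻¹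
    refine h1.congr (ae_of_all _ fun ω => ?_)
    have h2 := poissonKernel_cpow_child_sub hG s hy ω
    rw [← eq_inv_mul_iff_mul_eq₀ (natCast_cpow_ne_zero hG s)] at h2
    simp only [h2, Pi.add_apply]
    by_cases h : ω ∈ sector G o y
    · simp only [Set.indicator_of_mem h]
      ring
    · simp only [Set.indicator_of_notMem h]
      ring

theorem poissonTransform_child (hG : IsHomogeneousTree G q) (z : ℂ) {F : Boundary G o → ℂ}
    (hF : Integrable F (boundaryMeasure hG o)) {x y : V} (hy : y ∈ children G o x) {Q : ℂ}
    (hQ : Q = (q : ℂ) ^ (1 / 2 + Complex.I * z)) :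
    Q * poissonTransform hG o z F y = poissonTransform hG o z F x +
      (Q ^ 2 - 1) * Q ^ G.dist o x * ∫ ω in sector G o y, F ω ∂boundaryMeasure hG o := by
  rw [poissonTransform, poissonTransform, ← integral_const_mul,
    ← integral_indicator (measurableSet_sector y), ← integral_const_mul, ← integral_add
      (integrable_poissonKernel_cpow_mul hG _ hF x)
      ((hF.indicator (measurableSet_sector y)).const_mul _)]
  refine integral_congr_ae (ae_of_all _ fun ω => ?_)
  have h2 := poissonKernel_cpow_child_sub hG (1 / 2 + Complex.I * z) hy ω
  rw [← hQ] at h2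
  simp only [← mul_assoc, h2]
  by_cases h : ω ∈ sector G o y
  · simp only [Set.indicator_of_mem h]
    ring
  · simp only [Set.indicator_of_notMem h]
    ring

theorem real_sector_eq (hG : IsHomogeneousTree G q) {x y : V} (hy : y ∈ children G o x) :
    (boundaryMeasure hG o).real (sector G o y) = (((q : ℝ) + 1) * (q : ℝ) ^ G.dist o x)⁻¹ := by
  rw [measureReal_def, boundaryMeasure_sector, sectorMass, dist_of_mem_children hy,
    if_neg (Nat.succ_ne_zero _), Nat.add_sub_cancel]
  have h : ((q : ℝ≥0∞) + 1).toReal = (q : ℝ) + 1 := by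
    exact_mod_cast ENNReal.toReal_natCast (q + 1)
  simp [h]

theorem poissonTransform_root (hG : IsHomogeneousTree G q) (z : ℂ) (F : Boundary G o → ℂ) :
    poissonTransform hG o z F o = sectorAverage hG F o := by
  rw [sectorAverage, setAverage_eq, sector_root hG.isTree.connected, probReal_univ, inv_one,
    one_smul, setIntegral_univ, poissonTransform]
  refine integral_congr_ae (ae_of_all _ fun ω => ?_)
  simp only
  rw [poissonKernel_cpow_of_mem_sector _
    (by rw [sector_root hG.isTree.connected]; trivial), SimpleGraph.dist_self, pow_zero, one_mul]

/-- Parameters attached to `z`: `Q = q ^ (1/2 + iz)`, `w = q ^ (2iz)` and `c = 𝐜(z)`. -/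
structure IsSpectralParameter (q : ℕ) (z : ℝ) (Q w c : ℂ) : Prop where
  Q_eq : Q = (q : ℂ) ^ (1 / 2 + Complex.I * z)
  Q_ne_zero : Q ≠ 0
  Q_sq : Q ^ 2 = q * w
  norm_Q : ‖Q‖ = (q : ℝ) ^ (1 / 2 : ℝ)
  norm_w : ‖w‖ = 1
  w_ne_one : w ≠ 1
  c_eq : c = cFunction q z
  c_mul : c * (w - 1) = (q * w - 1) / (q + 1)
  c_ne_zero : c ≠ 0
  norm_one_sub_c : ‖1 - c‖ = ‖c‖

theorem exists_isSpectralParameter (hq : 2 ≤ q) {z : ℝ}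
    (hz : ∀ k : ℤ, z ≠ (k : ℝ) * (tau q / 2)) : ∃ Q w c, IsSpectralParameter q z Q w c := by
  have hq0 : q ≠ 0 := by omega
  have hq' : (q : ℂ) ≠ 0 := Nat.cast_ne_zero.2 hq0
  have hq1 : (q : ℂ) + 1 ≠ 0 := by exact_mod_cast Nat.succ_ne_zero q
  set w : ℂ := ((q : ℂ) ^ (Complex.I * z)) ^ 2 with hw
  have hw1 : w ≠ 1 := cpow_I_mul_sq_ne_one hq hz
  have hw1' : w - 1 ≠ 0 := sub_ne_zero.2 hw1
  have hwn : ‖w‖ = 1 := by rw [hw, norm_pow, norm_natCast_cpow_I_mul hq0, one_pow]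
  have hc := cFunction_eq hq0 hw
  have hne := natCast_mul_sub_one_ne_zero hq hwn
  refine ⟨(q : ℂ) ^ (1 / 2 + Complex.I * z), w, cFunction q z, rfl, ?_, ?_,
    norm_natCast_cpow_half_add hq0 z, hwn, hw1, rfl, ?_, ?_, ?_⟩
  · simp [Complex.cpow_eq_zero_iff, hq0]
  · rw [natCast_cpow_half_add hq0, mul_pow, natCast_cpow_half_sq]
  · rw [hc]
    field_simp
  · rw [hc]
    exact div_ne_zero hne (mul_ne_zero hq1 hw1')
  · have h : 1 - cFunction q z = (w - q) / (((q : ℂ) + 1) * (w - 1)) := by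
      rw [hc]
      field_simp
      ring
    rw [h, hc, norm_div, norm_div, norm_sub_natCast hwn]

/-- After multiplication by Q^{|x|} the jump carries Q^{2|x|} = q^{|x|} w^{|x|}, whose factor
q^{|x|} cancels against the mass 1/((q + 1) q^{|x|}) of E(y). The constant left is (qw − 1)/(q + 1)
= c(w − 1). -/
theorem isPoissonPair_poissonTransform (hG : IsHomogeneousTree G q) {z : ℝ} {Q w c : ℂ}
    (hs : IsSpectralParameter q z Q w c) {F : Boundary G o → ℂ}
    (hF : Integrable F (boundaryMeasure hG o)) :
    IsPoissonPair G o w c (sectorAverage hG F)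
      (fun x => Q ^ G.dist o x * poissonTransform hG o z F x) where
  childAverage_eq := childAverage_sectorAverage hG hF
  root := by rw [SimpleGraph.dist_self, pow_zero, one_mul, poissonTransform_root]
  child x y hy := by
    have hq' : (q : ℂ) ≠ 0 := Nat.cast_ne_zero.2 hG.ne_zero
    have hq1 : (q : ℂ) + 1 ≠ 0 := by exact_mod_cast Nat.succ_ne_zero q
    have h1 := poissonTransform_child hG z hF hy hs.Q_eq
    rw [← real_smul_sectorAverage, real_sector_eq hG hy, Complex.real_smul] at h1
    push_cast at h1
    have h2 : (Q ^ G.dist o x) ^ 2 = (q : ℂ) ^ G.dist o x * w ^ G.dist o x := by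
      rw [← pow_mul, mul_comm, pow_mul, hs.Q_sq, mul_pow]
    rw [dist_of_mem_children hy, pow_succ, mul_assoc, h1, hs.c_mul, hs.Q_sq]
    field_simp
    linear_combination (q * w - 1) * sectorAverage hG F y * h2

theorem hardyNorm_eq_iSup (hG : IsHomogeneousTree G q) (ω₀ : Boundary G o) {r : ℝ} (hr : 0 < r)
    {z : ℝ} {Q w c : ℂ} (hs : IsSpectralParameter q z Q w c) (u : V → ℂ) :
    hardyNorm hG ω₀ r u = ⨆ n : ℕ, levelNorm hG o r n fun x => Q ^ G.dist o x * u x := by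
  rw [hardyNorm_eq_iSup_levelNorm hG ω₀ hr]
  refine iSup_congr fun n => ?_
  rw [levelNorm_congr hG r (u := fun x => Q ^ G.dist o x * u x) (v := fun x => Q ^ n * u x)
    fun x hx => by rw [hx], levelNorm_mul]
  congr 1
  rw [← ofReal_norm, norm_pow, hs.norm_Q, ← Real.rpow_natCast, ← Real.rpow_mul (by positivity),
    ← ENNReal.ofReal_rpow_of_nonneg (by positivity) (by positivity), ENNReal.ofReal_natCast]
  congr 1
  ring

/-! ### The eigenvalue equation and recovery of the boundary function -/

theorem neighborFinset_root (G : SimpleGraph V) [G.LocallyFinite] (o : V) :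
    G.neighborFinset o = children G o o := by
  ext y
  rw [mem_children, SimpleGraph.mem_neighborFinset, SimpleGraph.dist_self, zero_add,
    SimpleGraph.dist_eq_one_iff_adj, and_self]

theorem sum_neighborFinset_of_ne (hG : G.IsTree) (u : V → ℂ) {x : V} (hx : x ≠ o) :
    ∑ y ∈ G.neighborFinset x, u y =
      u (parent hG.connected o x) + ∑ y ∈ children G o x, u y := by
  classical
  have hp := mem_children.1 (mem_children_parent hG.connected hx)
  rw [← Finset.sum_insert fun h => ?_]
  · refine Finset.sum_congr ?_ fun _ _ => rfl
    ext y
    rw [Finset.mem_insert, mem_children, SimpleGraph.mem_neighborFinset]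
    constructor
    · intro h
      rcases hG.dist_eq_dist_add_one_of_adj o h with h3 | h3
      · exact Or.inl (parent_eq hG (mem_children.2 ⟨h.symm, h3⟩)).symm
      · exact Or.inr ⟨h, h3⟩
    · rintro (rfl | h)
      · exact hp.1.symm
      · exact h.1
  · have := dist_of_mem_children h
    have := hp.2
    omega

/-- In terms of v = Q^{|x|} u the equation away from o compares the mean outgoing increment with the
incoming one, with ratio w. The root has q + 1 children and no parent, so its equation is of another
kind. -/
theorem laplacian_eq_iff (hG : IsHomogeneousTree G q) (o : V) {z : ℝ} {Q w c : ℂ}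
    (hs : IsSpectralParameter q z Q w c) {u v : V → ℂ} (hv : ∀ x, v x = Q ^ G.dist o x * u x) :
    (∀ x, laplacian G q u x = eigenvalue q z * u x) ↔
      (∀ x, x ≠ o → childAverage G o v x - v x =
        w * (v x - v (parent hG.isTree.connected o x))) ∧
      (q + 1) * childAverage G o v o = q * (w + 1) * v o := by
  have hq' : (q : ℂ) ≠ 0 := Nat.cast_ne_zero.2 hG.ne_zero
  have hq1 : (q : ℂ) + 1 ≠ 0 := by exact_mod_cast Nat.succ_ne_zero q
  have hQ := hs.Q_ne_zero
  have hsum : ∀ x, Q ^ (G.dist o x + 1) * ∑ y ∈ children G o x, u y =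
      (children G o x).card * childAverage G o v x := by
    intro x
    have h := card_smul_childAverage (o := o) hG v x
    rw [Complex.real_smul, Complex.ofReal_natCast] at h
    rw [h, Finset.mul_sum]
    exact Finset.sum_congr rfl fun y hy => by rw [hv, dist_of_mem_children hy]
  have h0 : ∀ x, laplacian G q u x = eigenvalue q z * u x ↔
      Q * ∑ y ∈ G.neighborFinset x, u y = (Q ^ 2 + q) * u x := by
    intro x
    rw [laplacian, eigenvalue, natCast_cpow_half_sub hG.ne_zero, ← hs.Q_eq]
    constructor
    · intro h
      field_simp at h
      linear_combination -h
    · intro h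
      field_simp
      linear_combination -h
  have h1 : ∀ x, x ≠ o → (laplacian G q u x = eigenvalue q z * u x ↔
      childAverage G o v x - v x = w * (v x - v (parent hG.isTree.connected o x))) := by
    intro x hx
    have hd := dist_of_mem_children (mem_children_parent hG.isTree.connected hx)
    have hs' := hsum x
    rw [card_children_of_ne hG hx] at hs'
    rw [h0, sum_neighborFinset_of_ne hG.isTree _ hx, hv (parent _ o x), hv x, hd]
    rw [hd] at hs'
    set n := G.dist o (parent hG.isTree.connected o x)
    have hQn : Q ^ (n + 1) ≠ 0 := pow_ne_zero _ hQ
    rw [← mul_right_inj' hQn]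
    rw [← mul_right_inj' hq' (b := childAverage G o v x - _)]
    constructor
    · intro h
      linear_combination h - hs' + (Q ^ (n + 1) * u x -
        Q ^ n * u (parent hG.isTree.connected o x)) * hs.Q_sq
    · intro h
      linear_combination h + hs' - (Q ^ (n + 1) * u x -
        Q ^ n * u (parent hG.isTree.connected o x)) * hs.Q_sq
  have h2 : laplacian G q u o = eigenvalue q z * u o ↔
      (q + 1) * childAverage G o v o = q * (w + 1) * v o := by
    have hs' := hsum o
    rw [card_children_root hG, SimpleGraph.dist_self, zero_add, pow_one] at hs'
    push_cast at hs'
    rw [h0, neighborFinset_root, hs', hv o, SimpleGraph.dist_self,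
      hs.Q_sq]
    constructor
    · intro h
      linear_combination h
    · intro h
      linear_combination h
  constructor
  · exact fun h => ⟨fun x hx => (h1 x hx).1 (h x), h2.1 (h o)⟩
  · intro h x
    by_cases hx : x = o
    · rw [hx]
      exact h2.2 h.2
    · exact (h1 x hx).2 (h.1 x hx)

theorem IsPoissonPair.childAverage_eq_add (hG : IsHomogeneousTree G q) {w c : ℂ} {f v : V → ℂ}
    (hp : IsPoissonPair G o w c f v) (x : V) :
    childAverage G o v x = v x + c * (w - 1) * w ^ G.dist o x * f x := by
  have h := hp.iterate_childAverage hG 1 x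
  rw [Function.iterate_one] at h
  rw [h]
  ring

theorem laplacian_poissonTransform (hG : IsHomogeneousTree G q) {z : ℝ} {Q w c : ℂ}
    (hs : IsSpectralParameter q z Q w c) {F : Boundary G o → ℂ}
    (hF : Integrable F (boundaryMeasure hG o)) (x : V) :
    laplacian G q (poissonTransform hG o z F) x = eigenvalue q z * poissonTransform hG o z F x := by
  have hp := isPoissonPair_poissonTransform hG hs hF
  refine (laplacian_eq_iff hG o hs fun _ => rfl).2 ⟨fun x hx => ?_, ?_⟩ x
  · have h1 := mem_children_parent hG.isTree.connected hx
    rw [hp.childAverage_eq_add hG, hp.child _ _ h1, dist_of_mem_children h1]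
    ring
  · have hq1 : (q : ℂ) + 1 ≠ 0 := by exact_mod_cast Nat.succ_ne_zero q
    rw [hp.childAverage_eq_add hG, ← hp.root, hs.c_mul, SimpleGraph.dist_self]
    field_simp
    ring

/-- The eigenvalue equation away from o multiplies increments by w on average, so after division by
w^{|x|} they form a martingale. The bound R may depend on z, since only membership in L^r is needed.
-/
theorem exists_isPoissonPair (hG : IsHomogeneousTree G q) {r : ℝ} (hr : 1 < r) {z : ℝ} {Q w c : ℂ}
    (hs : IsSpectralParameter q z Q w c) {v : V → ℂ}
    (hv : ∀ x, x ≠ o → childAverage G o v x - v x =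
      w * (v x - v (parent hG.isTree.connected o x)))
    {B : ℝ≥0∞} (hB : B < ∞) (hvB : ∀ n, levelNorm hG o r n v ≤ B) :
    ∃ f : V → ℂ, (∀ x, childAverage G o f x = f x) ∧
      (∀ x, ∀ y ∈ children G o x, v y - v x = c * (w - 1) * w ^ G.dist o x * f y) ∧
      ∃ R : NNReal, ∀ n, levelNorm hG o r n f ≤ R := by
  classical
  have hw0 : w ≠ 0 := norm_ne_zero_iff.1 (by rw [hs.norm_w]; exact one_ne_zero)
  set K := c * (w - 1) with hK
  have hK0 : K ≠ 0 := mul_ne_zero hs.c_ne_zero (sub_ne_zero.2 hs.w_ne_one)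
  set p := parent hG.isTree.connected o with hp
  set f₀ : V → ℂ := fun y => K⁻¹ * ((w ^ G.dist o (p y))⁻¹ * (v y - v (p y))) with hf₀
  -- No increment enters o; the martingale property forces the value there.
  set f : V → ℂ := fun x => if x = o then childAverage G o f₀ o else f₀ x with hf
  have hfc : ∀ x, ∀ y ∈ children G o x, f y = K⁻¹ * ((w ^ G.dist o x)⁻¹ * (v y - v x)) := by
    intro x y hy
    have hyo : y ≠ o := by
      rintro rfl
      have := dist_of_mem_children hy
      simp at this
    simp only [hf, if_neg hyo, hf₀]
    rw [hp, parent_eq hG.isTree hy]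
  have hcard : ∀ x, ((children G o x).card : ℝ) ≠ 0 := fun x => by
    exact_mod_cast (card_children_pos hG x).ne'
  have hav : ∀ x, childAverage G o f x =
      K⁻¹ * ((w ^ G.dist o x)⁻¹ * (childAverage G o v x - v x)) := by
    intro x
    have h1 := card_smul_childAverage (o := o) hG v x
    rw [childAverage, Finset.sum_congr rfl (hfc x), ← Finset.mul_sum, ← Finset.mul_sum,
      Finset.sum_sub_distrib, ← h1, Finset.sum_const, ← Nat.cast_smul_eq_nsmul ℝ, ← smul_sub,
      mul_smul_comm, mul_smul_comm, inv_smul_smul₀ (hcard x)]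
  refine ⟨f, fun x => ?_, fun x y hy => ?_, ?_⟩
  · by_cases hx : x = o
    · rw [hx]
      simp only [hf, if_true]
      rw [childAverage, childAverage]
      congr 1
      refine Finset.sum_congr rfl fun y hy => ?_
      rw [if_neg]
      rintro rfl
      have := dist_of_mem_children hy
      simp at this
    · have h1 := mem_children_parent hG.isTree.connected hx
      rw [hav, hv x hx, hfc _ x h1, dist_of_mem_children h1, pow_succ]
      field_simp
      rfl
  · rw [hfc x y hy]
    field_simp
  · have hfin : ‖f o‖ₑ + ‖K⁻¹‖ₑ * (B + B) ≠ ∞ :=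
      ENNReal.add_ne_top.2 ⟨enorm_ne_top, ENNReal.mul_ne_top enorm_ne_top
        (ENNReal.add_ne_top.2 ⟨hB.ne, hB.ne⟩)⟩
    refine ⟨(‖f o‖ₑ + ‖K⁻¹‖ₑ * (B + B)).toNNReal, fun n => ?_⟩
    rw [ENNReal.coe_toNNReal hfin]
    cases n with
    | zero =>
      rw [levelNorm_congr hG r (v := fun _ => f o) fun x hx => by
        rw [hG.isTree.connected.dist_eq_zero_iff.1 hx], levelNorm_const hG (by linarith)]
      exact le_self_add
    | succ n =>
      refine le_trans ?_ le_add_self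
      rw [levelNorm_congr hG r (v := fun x => K⁻¹ * ((w ^ n)⁻¹ * (v x + (-1) * v (p x))))
        fun x hx => ?_]
      · have hwn : ‖(w ^ n)⁻¹‖ₑ = 1 := by
          rw [← ofReal_norm, norm_inv, norm_pow, hs.norm_w]; simp
        rw [levelNorm_mul, levelNorm_mul, hwn, one_mul]
        gcongr
        refine (levelNorm_add_le hG hr.le _ _ _).trans (add_le_add (hvB _) ?_)
        rw [levelNorm_mul, enorm_neg, enorm_one, one_mul, levelNorm_comp_parent hG r n v]
        exact hvB n
      · have hxo : x ≠ o := by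
          rintro rfl
          simp at hx
        have h1 := mem_children_parent hG.isTree.connected hxo
        have h2 := dist_of_mem_children h1
        rw [hfc _ x h1, show G.dist o (parent hG.isTree.connected o x) = n by omega]
        ring

/-- The martingale of normalized increments yields F. Then v and the normalized transform of F have
the same increments, and it remains to match them at o. -/
theorem exists_eq_poissonTransform (hG : IsHomogeneousTree G q) (ω₀ : Boundary G o) {r : ℝ}
    (hr : 1 < r) {z : ℝ} {Q w c : ℂ} (hs : IsSpectralParameter q z Q w c) {u : V → ℂ}
    (hu : hardyNorm hG ω₀ r u < ∞) (heig : ∀ x, laplacian G q u x = eigenvalue q z * u x) :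
    ∃ F : Boundary G o → ℂ, MemLp F (ENNReal.ofReal r) (boundaryMeasure hG o) ∧
      u = poissonTransform hG o z F := by
  set v : V → ℂ := fun x => Q ^ G.dist o x * u x with hv
  have h1 := (laplacian_eq_iff hG o hs (v := v) fun _ => rfl).1 heig
  rw [hardyNorm_eq_iSup hG ω₀ (by linarith) hs] at hu
  obtain ⟨f, hf, hfv, R, hR⟩ := exists_isPoissonPair hG hr hs h1.1 hu
    fun n => le_iSup (fun n => levelNorm hG o r n v) n
  obtain ⟨F, hF, hFf⟩ := exists_sectorAverage_eq hG hr hf hR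
  have hint := hF.integrable (by simpa using hr.le)
  refine ⟨F, hF, ?_⟩
  have hp := isPoissonPair_poissonTransform hG hs hint
  set v' : V → ℂ := fun x => Q ^ G.dist o x * poissonTransform hG o z F x with hv'
  have h2 := (laplacian_eq_iff hG o hs (v := v') fun _ => rfl).1
    (laplacian_poissonTransform hG hs hint)
  have hd : ∀ x, v x - v' x = v o - v' o := by
    refine dist_induction hG.isTree.connected o rfl fun x y hy hx => ?_
    have h3 := hp.child x y hy
    rw [hFf] at h3
    linear_combination hfv x y hy - h3 + hx
  have hca : childAverage G o v o = childAverage G o v' o + (v o - v' o) := by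
    have hN : ((children G o o).card : ℝ) ≠ 0 := by
      exact_mod_cast (card_children_pos hG o).ne'
    rw [childAverage, childAverage, Finset.sum_congr rfl fun y _ =>
      (sub_eq_iff_eq_add'.1 (hd y) : v y = v' y + (v o - v' o)), Finset.sum_add_distrib,
      Finset.sum_const, ← Nat.cast_smul_eq_nsmul ℝ, smul_add, inv_smul_smul₀ hN]
  -- The constant d = v(o) − v'(o) satisfies the root equation, (q + 1) d = q(w + 1) d. Its
  -- coefficient qw − 1 is nonzero because |qw| = q ≥ 2.
  have h4 : ((q : ℂ) * w - 1) * (v o - v' o) = 0 := by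
    have h5 := h1.2
    rw [hca] at h5
    linear_combination h2.2 - h5
  have h6 := (mul_eq_zero.1 h4).resolve_left (natCast_mul_sub_one_ne_zero hG.two_le hs.norm_w)
  ext x
  have h7 := hd x
  rw [h6] at h7
  exact mul_left_cancel₀ (pow_ne_zero _ hs.Q_ne_zero) (sub_eq_zero.1 h7)

end Poisson

end HomTree

/-! ### The theorem -/

theorem mainTheorem2 {V : Type*} (G : SimpleGraph V) [G.LocallyFinite] (q : ℕ)
    (hG : HomTree.IsHomogeneousTree G q) (o : V) (ω₀ : HomTree.Boundary G o)
    (r : ℝ) (hr : 1 < r) :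
    (∀ z : ℝ, (∀ k : ℤ, z ≠ (k : ℝ) * (HomTree.tau q / 2)) → ∀ u : V → ℂ,
      ((∃ F : HomTree.Boundary G o → ℂ,
          MemLp F (ENNReal.ofReal r) (HomTree.boundaryMeasure hG o) ∧
          u = HomTree.poissonTransform hG o (z : ℂ) F) ↔
        (u ∈ HomTree.hardySpace hG ω₀ r ∧
          ∀ x, HomTree.laplacian G q u x = HomTree.eigenvalue q (z : ℂ) * u x))) ∧
    ∃ C₁ C₂ : ℝ, 0 < C₁ ∧ 0 < C₂ ∧
      ∀ z : ℝ, (∀ k : ℤ, z ≠ (k : ℝ) * (HomTree.tau q / 2)) →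
        ∀ F : HomTree.Boundary G o → ℂ,
          MemLp F (ENNReal.ofReal r) (HomTree.boundaryMeasure hG o) →
          ENNReal.ofReal (C₁ * ‖HomTree.cFunction q (z : ℂ)‖) *
              eLpNorm F (ENNReal.ofReal r) (HomTree.boundaryMeasure hG o) ≤
            HomTree.hardyNorm hG ω₀ r (HomTree.poissonTransform hG o (z : ℂ) F) ∧
          HomTree.hardyNorm hG ω₀ r (HomTree.poissonTransform hG o (z : ℂ) F) ≤
            ENNReal.ofReal (C₂ * ‖HomTree.cFunction q (z : ℂ)‖) *
              eLpNorm F (ENNReal.ofReal r) (HomTree.boundaryMeasure hG o) := by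
  have hr0 : 0 < r := by linarith
  obtain ⟨C, hC, hCv⟩ := HomTree.exists_levelNorm_le_of_isPoissonPair hG o hr
  have upper : ∀ z : ℝ, (∀ k : ℤ, z ≠ (k : ℝ) * (HomTree.tau q / 2)) →
      ∀ F : HomTree.Boundary G o → ℂ,
        MemLp F (ENNReal.ofReal r) (HomTree.boundaryMeasure hG o) →
        HomTree.hardyNorm hG ω₀ r (HomTree.poissonTransform hG o (z : ℂ) F) ≤
          ENNReal.ofReal (C * ‖HomTree.cFunction q (z : ℂ)‖) *
            eLpNorm F (ENNReal.ofReal r) (HomTree.boundaryMeasure hG o) := by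
    intro z hz F hF
    obtain ⟨Q, w, c, hs⟩ := HomTree.exists_isSpectralParameter hG.two_le hz
    have hint := hF.integrable (by simpa using hr.le)
    rw [HomTree.hardyNorm_eq_iSup hG ω₀ hr0 hs, ← hs.c_eq]
    exact iSup_le (hCv w c _ _ hs.norm_w hs.c_ne_zero hs.norm_one_sub_c
      (HomTree.isPoissonPair_poissonTransform hG hs hint) _
      fun n => HomTree.levelNorm_sectorAverage_le hG hr.le n hint)
  -- The averaging argument gives the lower constant 1; C comes from Burkholder's inequality and
  -- depends only on the tree and r.
  refine ⟨fun z hz u => ⟨?_, ?_⟩, 1, C, one_pos, hC, fun z hz F hF => ⟨?_, upper z hz F hF⟩⟩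
  · rintro ⟨F, hF, rfl⟩
    obtain ⟨Q, w, c, hs⟩ := HomTree.exists_isSpectralParameter hG.two_le hz
    exact ⟨(upper z hz F hF).trans_lt (ENNReal.mul_lt_top ENNReal.ofReal_lt_top hF.2),
      HomTree.laplacian_poissonTransform hG hs (hF.integrable (by simpa using hr.le))⟩
  · rintro ⟨hu, heig⟩
    obtain ⟨Q, w, c, hs⟩ := HomTree.exists_isSpectralParameter hG.two_le hz
    exact HomTree.exists_eq_poissonTransform hG ω₀ hr hs hu heig
  · obtain ⟨Q, w, c, hs⟩ := HomTree.exists_isSpectralParameter hG.two_le hz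
    have hint := hF.integrable (by simpa using hr.le)
    rw [one_mul, ofReal_norm, ← hs.c_eq, HomTree.hardyNorm_eq_iSup hG ω₀ hr0 hs, mul_comm,
      ← ENNReal.le_div_iff_mul_le (Or.inl (by simpa using hs.c_ne_zero)) (Or.inl enorm_ne_top)]
    refine HomTree.eLpNorm_le_of_levelNorm_sectorAverage_le hG hint fun n => ?_
    rw [ENNReal.le_div_iff_mul_le (Or.inl (by simpa using hs.c_ne_zero)) (Or.inl enorm_ne_top),
      mul_comm]
    exact (HomTree.isPoissonPair_poissonTransform hG hs hint).mul_levelNorm_le hG hr hs.norm_w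
      hs.w_ne_one (fun n => le_iSup
        (fun n => HomTree.levelNorm hG o r n fun x =>
          Q ^ G.dist o x * HomTree.poissonTransform hG o (z : ℂ) F x) n) n
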